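/- **Setting.** Let $d=M+1$ and let $h(\mathbf w;\boldsymbol\theta)$, $\boldsymbol\theta=(\theta_1,\dots,\theta_p)$, be a parametric family of angular densities on the open unit simplex of $\mathbb R^d$: $h>0$ and $\int w_j\,h(\mathbf w;\boldsymbol\theta)\,d\mathbf w=1$ for $j=1,\dots,d$. Covariates $\mathbf x=(x_1,\dots,x_q)$ range over a box $\mathcal X=\prod_k[a_k,b_k]$ and act through a vector generalized additive model: with link functions $g_l$, $g_l(\theta_{l,\mathbf x})=\eta_l(\mathbf x)=\beta_{[0]l}+\sum_{k=1}^q\sum_{s=1}^{\tilde d}\beta_{[kl]_s}b_{k,s}(x_k)$ for $l=1,\dots,p$, that is $\boldsymbol\eta(\mathbf x)=X_{\rm VAM}(\mathbf x)\boldsymbol\beta$ with a $p\times p(1+q\tilde d)$ matrix $X_{\rm VAM}(\mathbf x)$. For each $k$, the functions $b_{k,s}$ are fixed linear combinations of the B-splines of a given order with equidistant internal knots on $[a_k,b_k]$ (the B-splines themselves, or a basis reduced by linear identifiability constraints such as centring). Fix a threshold $\mathbf r\in(0,\infty)^d$ and let $E_{\mathbf r}=\{\mathbf y\in(0,\infty)^d:\sum_j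 y_j/r_j>1\}$. With $\|\cdot\|_1$ the $L_1$-norm, put $$\ell(\mathbf x,\mathbf y;\boldsymbol\beta)=-(d+1)\log\|\mathbf y\|_1+\log h(\mathbf y/\|\mathbf y\|_1;\boldsymbol\theta_{\mathbf x}),\qquad f(\mathbf y\mid\mathbf x;\boldsymbol\beta)=\frac{e^{\ell(\mathbf x,\mathbf y;\boldsymbol\beta)}}{\sum_j r_j^{-1}}\quad(\mathbf y\in E_{\mathbf r}),$$ and $\mathbf m=\partial\ell/\partial\boldsymbol\beta$. Under $\boldsymbol\beta$, an observation $(\mathbf x,\mathbf Y)$ has covariate law $\nu$, a probability measure on $\mathcal X$, and $\mathbf Y$ given $\mathbf x$ has density $f(\cdot\mid\mathbf x;\boldsymbol\beta)$ on $E_{\mathbf r}$; $\mathrm E_{\boldsymbol\beta}$, $\mathrm{cov}_{\boldsymbol\beta}$ refer to this law. Let $(\mathbf x^i,\mathbf Y^i)$, $i\ge1$, be independent with this law at the true value $\boldsymbol\beta_0$, and write $n=n_{\mathbf r}$ for the number of (extreme) observations used. The parameter set $\mathbf B\subset\mathbb R^{p(1+q\tilde d)}$ is compact, every $\boldsymbol\beta\in\mathbf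 B$ gives predictors $\eta_l(\mathbf x)$ in the range of $g_l$ for all $\mathbf x\in\mathcal X$, and $\ell(\mathbf x,\mathbf y;\cdot)$ is continuous on $\mathbf B$ for $\mathbf x\in\mathcal X$, $\mathbf y\in(0,\infty)^d$. The penalized maximum likelihood estimator $\hat{\boldsymbol\beta}$ is any measurable maximizer over $\mathbf B$ of $$\sum_{i=1}^{n}\ell(\mathbf x^i,\mathbf Y^i;\boldsymbol\beta)-\tfrac12\sum_{k=1}^q\sum_{l=1}^p\gamma_{(l)k}\,\boldsymbol\beta_{[kl]}^{\mathsf T}\mathbf P_k\boldsymbol\beta_{[kl]},$$ with fixed positive semidefinite matrices $\mathbf P_k$ and deterministic smoothing parameters $\gamma_{(l)k}=\gamma_{(l)k}(n)\ge0$. **Assumptions.** (A1) $\gamma_{(l)k}=o(n^{-1/2})$ for all $l,k$. (A2) There is an open neighbourhood $\mathbf B_0\subset\mathbf B$ of $\boldsymbol\beta_0$ (so $\boldsymbol\beta_0$ is interior to $\mathbf B$) such that: 1. if $\boldsymbol\beta\ne\tilde{\boldsymbol\beta}$ in $\mathbf B$, then $\ell(\cdot;\boldsymbol\beta)$ and $\ell(\cdot;\tilde{\boldsymbol\beta})$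 are not equal $\nu(d\mathbf x)\,d\mathbf y$-almost everywhere on $\mathcal X\times E_{\mathbf r}$; and $\mathrm E_{\boldsymbol\beta_0}\sup_{\boldsymbol\beta\in\mathbf B}|\ell(\mathbf x,\mathbf Y;\boldsymbol\beta)|<\infty$; 2. $\ell(\mathbf x,\mathbf y;\cdot)\in C^3(\mathbf B_0)$ for all $\mathbf x\in\mathcal X$, $\mathbf y\in(0,\infty)^d$; 3. $\iint_{E_{\mathbf r}}\sup_{\mathbf B_0}\|\partial f/\partial\boldsymbol\beta\|\,d\mathbf y\,\nu(d\mathbf x)<\infty$ and $\iint_{E_{\mathbf r}}\sup_{\mathbf B_0}\|\partial^2 f/\partial\boldsymbol\beta\,\partial\boldsymbol\beta^{\mathsf T}\|\,d\mathbf y\,\nu(d\mathbf x)<\infty$; 4. for $\boldsymbol\beta\in\mathbf B_0$ the information matrix $\mathbf i(\boldsymbol\beta)=\mathrm{cov}_{\boldsymbol\beta}\{\mathbf m(\mathbf x,\mathbf Y;\boldsymbol\beta)\}$ exists (the score is square integrable) and is positive definite; 5. for all indices $a,b,c$ there is a function $M_{abc}(\mathbf x,\mathbf y)$ with $|\partial^3\ell(\mathbf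 x,\mathbf y;\boldsymbol\beta)/\partial\beta_a\partial\beta_b\partial\beta_c|\le M_{abc}(\mathbf x,\mathbf y)$ for $\mathbf x\in\mathcal X$, $\mathbf y\in(0,\infty)^d$, $\boldsymbol\beta\in\mathbf B_0$, and $\mathrm E_{\boldsymbol\beta_0}M_{abc}<\infty$. **Theorem 1.** Under these assumptions $\mathbf i(\boldsymbol\beta)=\mathrm E_{\boldsymbol\beta}\{X_{\rm VAM}(\mathbf x)^{\mathsf T}\,\mathbf W\,X_{\rm VAM}(\mathbf x)\}$ with $\mathbf W=-\partial^2\ell/\partial\boldsymbol\eta\,\partial\boldsymbol\eta^{\mathsf T}$, for $\boldsymbol\beta\in\mathbf B_0$, and as $n\to\infty$, $$\|\hat{\boldsymbol\beta}-\boldsymbol\beta_0\|=O_p(n^{-1/2}),\qquad \sqrt n\,(\hat{\boldsymbol\beta}-\boldsymbol\beta_0)\ \xrightarrow{\ d\ }\ N\bigl(\mathbf 0,\mathbf i(\boldsymbol\beta_0)^{-1}\bigr).$$ -/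

import Mathlib

open MeasureTheory ProbabilityTheory Filter Topology Asymptotics
open scoped Matrix ENNReal

noncomputable section

namespace AngularReg

/-! ### B-splines -/

/-- Knot sequences for B-splines of degree `deg` (order `deg + 1`) on `[a, b]` with `m` equidistant
internal knots.  The outer knots are only required to be in nondecreasing order, so that both
repeated boundary knots and equidistant outer knots are covered. -/
structure IsEquidistantKnots (deg m : ℕ) (a b : ℝ) (t : ℕ → ℝ) : Prop where
  mono : Monotone t
  inner : ∀ j ≤ m + 1, t (deg + j) = a + j * ((b - a) / (m + 1))

/-- The Cox-de Boor recursion: `bspline t b deg s` is the `s`-th B-spline of degree `deg` (order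
`deg + 1`) with knots `t`.  Here `0 / 0 = 0`, as usual.  Pieces are taken right-continuous at the
points left of the right end point `b` of the covariate range and left-continuous at `b`. -/
def bspline (t : ℕ → ℝ) (b : ℝ) : ℕ → ℕ → ℝ → ℝ
  | 0, s, x =>
      open Classical in
      if (x < b ∧ t s ≤ x ∧ x < t (s + 1)) ∨ (b ≤ x ∧ t s < x ∧ x ≤ t (s + 1)) then 1 else 0
  | r + 1, s, x =>
      (x - t s) / (t (s + r + 1) - t s) * bspline t b r s x
        + (t (s + r + 2) - x) / (t (s + r + 2) - t (s + 1)) * bspline t b r (s + 1) x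

/-! ### The unit simplex and the extreme region -/

/-- The open unit simplex of `ℝ ^ (M + 1)` in the coordinates `w₁, …, w_M`. -/
def simplexChart (M : ℕ) : Set (Fin M → ℝ) := {v | (∀ i, 0 < v i) ∧ ∑ i, v i < 1}

/-- The point `(w₁, …, w_M, 1 - w₁ - ⋯ - w_M)` of the simplex. -/
def simplexPoint {M : ℕ} (v : Fin M → ℝ) : Fin (M + 1) → ℝ :=
  Fin.snoc (α := fun _ => ℝ) v (1 - ∑ i, v i)

/-- `(0, ∞) ^ d`. -/
def posOrthant (d : ℕ) : Set (Fin d → ℝ) := {y | ∀ j, 0 < y j}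

/-- The extreme region `E_r = {y ∈ (0, ∞) ^ d : ∑ y_j / r_j > 1}`. -/
def extremeSet {d : ℕ} (r : Fin d → ℝ) : Set (Fin d → ℝ) :=
  {y | (∀ j, 0 < y j) ∧ 1 < ∑ j, y j / r j}

/-- The `L¹`-norm. -/
def l1 {d : ℕ} (y : Fin d → ℝ) : ℝ := ∑ j, |y j|

/-- The angular component `y / ‖y‖₁`. -/
def angle {d : ℕ} (y : Fin d → ℝ) : Fin d → ℝ := fun j => y j / l1 y

/-! ### The coefficient vector -/

/-- Indices of the coefficients `β`: `p` intercepts, and for each covariate `k`, each predictor `l`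
and each basis function `s` the coefficient `β_{[kl]_s}`; there are `p (1 + q D)` of them. -/
abbrev CoefIdx (p q D : ℕ) : Type := Fin p ⊕ (Fin q × Fin p × Fin D)

/-- The space of coefficient vectors, `ℝ ^ (p (1 + q D))` with its Euclidean norm. -/
abbrev Coef (p q D : ℕ) : Type := EuclideanSpace ℝ (CoefIdx p q D)

/-- A single observation `(x, y)`: covariate vector and (extreme) response vector. -/
abbrev Obs (M q : ℕ) : Type := (Fin q → ℝ) × (Fin (M + 1) → ℝ)

/-- A vector generalized additive model for covariate-adjusted angular densities in dimension
`d = M + 1`, with `p` parameters, `q` covariates and `D` basis functions per smooth term. -/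
structure Model (M p q D : ℕ) where
  /-- the parametric family of angular densities `h(w; θ)`, with respect to `dw₁ ⋯ dw_M` -/
  h : (Fin (M + 1) → ℝ) → (Fin p → ℝ) → ℝ
  /-- the link functions `g_l`, bijections from the range of the parameter `θ_l` to a set of
  predictor values -/
  link : Fin p → PartialEquiv ℝ ℝ
  measurable_h : Measurable (Function.uncurry h)
  measurable_link_symm : ∀ l, Measurable (link l).symm
  h_pos : ∀ θ : Fin p → ℝ, (∀ l, θ l ∈ (link l).source) →
    ∀ v ∈ simplexChart M, 0 < h (simplexPoint v) θ
  /-- the moment constraints `∫ w_j dH(w) = 1` of an angular measure -/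
  moment : ∀ θ : Fin p → ℝ, (∀ l, θ l ∈ (link l).source) → ∀ j,
    ∫⁻ v in simplexChart M, ENNReal.ofReal (simplexPoint v j * h (simplexPoint v) θ) = 1
  /-- the threshold vector `r` -/
  thr : Fin (M + 1) → ℝ
  thr_pos : ∀ j, 0 < thr j
  /-- the range `[lo_k, hi_k]` of the `k`-th covariate -/
  lo : Fin q → ℝ
  hi : Fin q → ℝ
  lo_lt_hi : ∀ k, lo k < hi k
  /-- degree of the splines (order minus one) -/
  deg : ℕ
  /-- number of internal knots -/
  nknots : Fin q → ℕ
  knot : Fin q → ℕ → ℝ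
  isKnots : ∀ k, IsEquidistantKnots deg (nknots k) (lo k) (hi k) (knot k)
  /-- The basis functions of the `k`-th smooth terms are `∑ t, Z_k(t, s) B_t`, `1 ≤ s ≤ D`, where
  `B_t` are the `deg + 1 + nknots k` B-splines.  The choice `Z_k = 1` gives the B-splines
  themselves; other choices absorb linear identifiability constraints such as centring. -/
  Z : ∀ k : Fin q, Matrix (Fin (deg + 1 + nknots k)) (Fin D) ℝ
  /-- the penalty matrices `P_k` -/
  pen : Fin q → Matrix (Fin D) (Fin D) ℝ
  pen_posSemidef : ∀ k, (pen k).PosSemidef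

namespace Model

variable {M p q D : ℕ} (𝓜 : Model M p q D)

/-- The covariate space `𝒳 = 𝒳₁ × ⋯ × 𝒳_q`. -/
def covSpace : Set (Fin q → ℝ) := Set.Icc 𝓜.lo 𝓜.hi

/-- The `s`-th basis function of the smooth terms in the `k`-th covariate. -/
def basisFun (k : Fin q) (s : Fin D) (x : ℝ) : ℝ :=
  ∑ t, 𝓜.Z k t s * bspline (𝓜.knot k) (𝓜.hi k) 𝓜.deg t x

/-- The `p` rows of `X_VAM` that belong to an observation with covariates `x`. -/
def design (x : Fin q → ℝ) : Matrix (Fin p) (CoefIdx p q D) ℝ :=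
  Matrix.of fun l a => match a with
    | Sum.inl l' => if l = l' then 1 else 0
    | Sum.inr (k, l', s) => if l = l' then 𝓜.basisFun k s (x k) else 0

/-- The predictors `η(x) = X_VAM β`. -/
def predictor (x : Fin q → ℝ) (β : Coef p q D) : Fin p → ℝ :=
  𝓜.design x *ᵥ (WithLp.ofLp β)

/-- `β` is admissible: at every `x ∈ 𝒳` the predictors are values of the link functions, so that
`θ_x = g⁻¹(η(x))` is a parameter of the family. -/
def Admissible (β : Coef p q D) : Prop :=
  ∀ x ∈ 𝓜.covSpace, ∀ l, 𝓜.predictor x β l ∈ (𝓜.link l).target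

/-- `ℓ_{E_r}(y, θ) = -(d + 1) log ‖y‖ + log h(y / ‖y‖; θ)`, with `d = M + 1`. -/
def logLikTheta (y : Fin (M + 1) → ℝ) (θ : Fin p → ℝ) : ℝ :=
  -((M : ℝ) + 2) * Real.log (l1 y) + Real.log (𝓜.h (angle y) θ)

/-- The log-likelihood contribution of `y` as a function of the predictor vector `η`. -/
def logLikEta (y : Fin (M + 1) → ℝ) (η : Fin p → ℝ) : ℝ :=
  𝓜.logLikTheta y fun l => (𝓜.link l).symm (η l)

/-- The log-likelihood contribution of one observation, as a function of `β`. -/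
def logLik (z : Obs M q) (β : Coef p q D) : ℝ := 𝓜.logLikEta z.2 (𝓜.predictor z.1 β)

/-- The score contribution `m = ∂ℓ/∂β`. -/
def score (z : Obs M q) (β : Coef p q D) : Coef p q D := gradient (𝓜.logLik z) β

/-- The matrix `-∂²ℓ/∂η∂ηᵀ` for one observation (working weights). -/
def weight (z : Obs M q) (β : Coef p q D) : Matrix (Fin p) (Fin p) ℝ :=
  Matrix.of fun l l' => -iteratedFDeriv ℝ 2 (𝓜.logLikEta z.2) (𝓜.predictor z.1 β)
    ![Pi.single l 1, Pi.single l' 1]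

/-- The conditional density at `y ∈ E_r` of an extreme observation given its covariates: the
intensity `‖y‖ ^ (-(d + 1)) h(y / ‖y‖; θ_x)` of the limiting Poisson process, divided by the
expected number `∑ 1 / r_j` of its points in `E_r`. -/
def density (z : Obs M q) (β : Coef p q D) : ℝ :=
  (l1 z.2 ^ (M + 2))⁻¹ *
    𝓜.h (angle z.2) (fun l => (𝓜.link l).symm (𝓜.predictor z.1 β l)) / ∑ j, (𝓜.thr j)⁻¹

/-- The reference measure `ν(dx) dy` on `ℝ ^ q × E_r`. -/
def refMeasure (ν : Measure (Fin q → ℝ)) : Measure (Obs M q) :=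
  ν.prod (volume.restrict (extremeSet 𝓜.thr))

/-- The law of one observation `(x, Y)` under `β`: the covariates have law `ν`, and given `x` the
response is an extreme observation from the model with angular density `h(·; θ_x)`. -/
def law (ν : Measure (Fin q → ℝ)) (β : Coef p q D) : Measure (Obs M q) :=
  (𝓜.refMeasure ν).withDensity fun z => ENNReal.ofReal (𝓜.density z β)

/-- The information matrix `i(β) = cov {m(Y, β)}`, under the law with parameter `β`. -/
def info (ν : Measure (Fin q → ℝ)) (β : Coef p q D) :
    Matrix (CoefIdx p q D) (CoefIdx p q D) ℝ :=
  Matrix.of fun a b => cov[fun z => 𝓜.score z β a, fun z => 𝓜.score z β b; 𝓜.law ν β]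

/-- The penalty matrix `P(γ)`: zero on the intercepts, block diagonal with blocks
`γ_{(l)k} P_k`. -/
def penalty (γ : Fin p → Fin q → ℝ) : Matrix (CoefIdx p q D) (CoefIdx p q D) ℝ :=
  Matrix.of fun a b => match a, b with
    | Sum.inr (k, l, s), Sum.inr (k', l', s') =>
        if k = k' ∧ l = l' then γ l k * 𝓜.pen k s s' else 0
    | _, _ => 0

/-- The penalized log-likelihood `ℓ(β, γ) = ∑ ℓ(Yⁱ; β) - βᵀ P(γ) β / 2` of the first `n` (extreme)
observations. -/
def penLogLik (n : ℕ) (z : ℕ → Obs M q) (γ : Fin p → Fin q → ℝ) (β : Coef p q D) : ℝ :=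
  ∑ i ∈ Finset.range n, 𝓜.logLik (z i) β
    - 1 / 2 * (WithLp.ofLp β ⬝ᵥ (𝓜.penalty γ *ᵥ WithLp.ofLp β))

/-- `β̂` is a penalized maximum likelihood estimate over the parameter set `B`. -/
def IsPMLE (n : ℕ) (z : ℕ → Obs M q) (γ : Fin p → Fin q → ℝ) (B : Set (Coef p q D))
    (βhat : Coef p q D) : Prop :=
  βhat ∈ B ∧ ∀ β ∈ B, 𝓜.penLogLik n z γ β ≤ 𝓜.penLogLik n z γ βhat

/-- The regularity conditions, for the covariate law `ν`, the parameter set `B`, the true parameter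
`β₀` and a neighbourhood `B₀` of it. -/
structure Regular (ν : Measure (Fin q → ℝ)) (B B₀ : Set (Coef p q D)) (β₀ : Coef p q D) :
    Prop where
  /-- identifiability -/
  ident : ∀ β ∈ B, ∀ β' ∈ B, β ≠ β' →
    ¬ ((fun z => 𝓜.logLik z β) =ᵐ[𝓜.refMeasure ν] fun z => 𝓜.logLik z β')
  /-- dominated log-likelihood -/
  dom : ∫⁻ z, ⨆ β ∈ B, ‖𝓜.logLik z β‖ₑ ∂(𝓜.law ν β₀) < ∞
  /-- the true parameter is an interior point -/
  interior : β₀ ∈ interior B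
  isOpen : IsOpen B₀
  mem : β₀ ∈ B₀
  subset : B₀ ⊆ B
  smooth : ∀ x ∈ 𝓜.covSpace, ∀ y ∈ posOrthant (M + 1), ContDiffOn ℝ 3 (𝓜.logLik (x, y)) B₀
  /-- integrable suprema of the first two derivatives of the density with respect to `β` -/
  dom_deriv : ∫⁻ z, ⨆ β ∈ B₀, ‖fderiv ℝ (𝓜.density z) β‖ₑ ∂(𝓜.refMeasure ν) < ∞
  dom_deriv_two :
    ∫⁻ z, ⨆ β ∈ B₀, ‖iteratedFDeriv ℝ 2 (𝓜.density z) β‖ₑ ∂(𝓜.refMeasure ν) < ∞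
  /-- the information matrix exists and is positive definite -/
  score_memLp : ∀ β ∈ B₀, ∀ a, MemLp (fun z => 𝓜.score z β a) 2 (𝓜.law ν β)
  info_posDef : ∀ β ∈ B₀, (𝓜.info ν β).PosDef
  /-- dominated third derivatives -/
  dom_third : ∀ a b c : CoefIdx p q D, ∃ F : Obs M q → ℝ, Integrable F (𝓜.law ν β₀) ∧
    ∀ x ∈ 𝓜.covSpace, ∀ y ∈ posOrthant (M + 1), ∀ β ∈ B₀,
      |iteratedFDeriv ℝ 3 (𝓜.logLik (x, y)) β
        ![EuclideanSpace.single a 1, EuclideanSpace.single b 1, EuclideanSpace.single c 1]|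
        ≤ F (x, y)

end Model

/-- `X_n = O_p(a_n)`. -/
def IsBigOInProb {Ω : Type*} [MeasurableSpace Ω] (P : Measure Ω) (X : ℕ → Ω → ℝ) (a : ℕ → ℝ) :
    Prop :=
  ∀ ε : ℝ, 0 < ε → ∃ C : ℝ, ∀ᶠ n in atTop, P {ω | C * a n < |X n ω|} ≤ ENNReal.ofReal ε

end AngularReg

end

namespace AngularReg

set_option maxSynthPendingDepth 3

/-! ### Parametrized derivatives: measurability and differentiation under the integral -/

section Param

variable {Z : Type*} [MeasurableSpace Z] {μ : Measure Z}
  {F : Type*} [NormedAddCommGroup F] [NormedSpace ℝ F]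

/-! The estimator is treated as a penalized M-estimator, by Cramér's route. Integrating the
intensity in `L¹`-polar coordinates, the moment constraints show that every admissible `β` gives a
true probability density (`lintegral_extremeSet_intensity`, `lintegral_density`). Differentiating `∫
f = 1` twice under the integral gives a centred score and `E(-∂²ℓ) = i(β)`; since `η` is linear in
`β`, the Hessian in `β` is that in `η` sandwiched between design matrices (`design_weight_design`).
This is the information formula.

Consistency: `β₀` is the unique maximizer of the expected log-likelihood (`integral_logLik_lt`), the
averages converge uniformly on `B` by the strong law in the Banach space of continuous functions,
and the penalty is uniformly negligible.

Normality: write `T = √n (β̂ - β₀)`, and let `W` be the sum of the scores multiplied by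
`i(β₀)⁻¹/√n`. A Taylor expansion of the score equation gives, path by path, `‖T - W‖ ≤ ε ‖T‖ + δ`
with `ε, δ → 0`; hence `‖T - W‖ / (1 + ‖W‖) → 0` almost surely (`tendsto_relative_error`). The
central limit theorem makes `W` tight, so `T - W → 0` in probability and `T` inherits the Gaussian
limit. Tightness of `T` is the root-`n` rate. -/

theorem aestronglyMeasurable_fderiv_apply {E : Type*} [NormedAddCommGroup E] [NormedSpace ℝ E]
    {f : Z → E → F} {U : Set E} (hU : IsOpen U)
    (hf : ∀ β ∈ U, AEStronglyMeasurable (fun z => f z β) μ) {β : E} (hβ : β ∈ U)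
    (hd : ∀ᵐ z ∂μ, DifferentiableAt ℝ (f z) β) (v : E) :
    AEStronglyMeasurable (fun z => fderiv ℝ (f z) β v) μ := by
  have hlim : Tendsto (fun n : ℕ => β + (n : ℝ)⁻¹ • v) atTop (𝓝 β) := by
    have : Tendsto (fun n : ℕ => (n : ℝ)⁻¹ • v) atTop (𝓝 ((0 : ℝ) • v)) :=
      (tendsto_inv_atTop_zero.comp tendsto_natCast_atTop_atTop).smul_const v
    simpa using this.const_add β
  obtain ⟨N, hN⟩ := eventually_atTop.1 (hlim.eventually (hU.mem_nhds hβ))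
  -- The shift by `N` keeps `β + v / (n + N)` inside `U`, where measurability is given.
  refine aestronglyMeasurable_of_tendsto_ae atTop
    (f := fun (n : ℕ) z => ((n + N : ℕ) : ℝ) • (f z (β + ((n + N : ℕ) : ℝ)⁻¹ • v) - f z β))
    (fun n => ((hf _ (hN _ (Nat.le_add_left N n))).sub (hf β hβ)).const_smul _) ?_
  filter_upwards [hd] with z hz
  exact (hz.hasFDerivAt.lim_real v).comp
    (tendsto_natCast_atTop_atTop.comp (tendsto_add_atTop_nat N))

variable {ι : Type*} [Fintype ι] [DecidableEq ι]

/-- In finite dimension `L z` is a finite sum of rank-one maps depending continuously on the vectors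
`L z eᵢ`. -/
theorem aestronglyMeasurable_clm {L : Z → EuclideanSpace ℝ ι →L[ℝ] F}
    (hL : ∀ v, AEStronglyMeasurable (fun z => L z v) μ) : AEStronglyMeasurable L μ := by
  have : L = fun z => ∑ i, ContinuousLinearMap.smulRightL ℝ (EuclideanSpace ℝ ι) F
      (EuclideanSpace.proj i) (L z (EuclideanSpace.single i 1)) := by
    funext z
    refine ContinuousLinearMap.ext fun v => ?_
    conv_lhs => rw [← (EuclideanSpace.basisFun ι ℝ).sum_repr v]
    simp
  rw [this]
  exact Finset.aestronglyMeasurable_fun_sum _ fun i _ =>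
    (ContinuousLinearMap.continuous _).comp_aestronglyMeasurable (hL _)

theorem aestronglyMeasurable_fderiv {f : Z → EuclideanSpace ℝ ι → F}
    {U : Set (EuclideanSpace ℝ ι)} (hU : IsOpen U)
    (hf : ∀ β ∈ U, AEStronglyMeasurable (fun z => f z β) μ)
    (hd : ∀ᵐ z ∂μ, DifferentiableOn ℝ (f z) U) :
    ∀ β ∈ U, AEStronglyMeasurable (fun z => fderiv ℝ (f z) β) μ := fun β hβ =>
  aestronglyMeasurable_clm fun v => aestronglyMeasurable_fderiv_apply hU hf hβ
    (hd.mono fun _ hz => (hz β hβ).differentiableAt (hU.mem_nhds hβ)) v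

/-- By continuity, the uncountable supremum agrees almost everywhere with the one over a countable
dense subset of `S`. -/
theorem aemeasurable_biSup_enorm {E G : Type*} [PseudoMetricSpace E] [SecondCountableTopology E]
    [NormedAddCommGroup G] {g : Z → E → G} {S : Set E}
    (hc : ∀ᵐ z ∂μ, ContinuousOn (g z) S)
    (hm : ∀ β ∈ S, AEStronglyMeasurable (fun z => g z β) μ) :
    AEMeasurable (fun z => ⨆ β ∈ S, ‖g z β‖ₑ) μ := by
  obtain ⟨D, hDS, hD, hSD⟩ :=
    (TopologicalSpace.IsSeparable.of_separableSpace S).exists_countable_dense_subset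
  have h : AEMeasurable (fun z => ⨆ β ∈ D, ‖g z β‖ₑ) μ :=
    AEMeasurable.biSup D hD fun β hβ => (hm β (hDS hβ)).enorm
  refine h.congr ?_
  filter_upwards [hc] with z hz
  refine le_antisymm (biSup_mono hDS) (iSup₂_le fun β hβ => ?_)
  have hβ' : (𝓝[D] β).NeBot := mem_closure_iff_nhdsWithin_neBot.1 (hSD hβ)
  have ht : Tendsto (fun b => ‖g z b‖ₑ) (𝓝[D] β) (𝓝 ‖g z β‖ₑ) :=
    (continuous_enorm.tendsto _).comp ((hz β hβ).mono_left (nhdsWithin_mono _ hDS))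
  exact le_of_tendsto ht (eventually_nhdsWithin_of_forall fun b hb =>
    le_iSup₂ (f := fun b (_ : b ∈ D) => ‖g z b‖ₑ) b hb)

theorem exists_integrable_bound {E G : Type*} [PseudoMetricSpace E] [SecondCountableTopology E]
    [NormedAddCommGroup G] {g : Z → E → G} {S : Set E}
    (hc : ∀ᵐ z ∂μ, ContinuousOn (g z) S)
    (hm : ∀ β ∈ S, AEStronglyMeasurable (fun z => g z β) μ)
    (hfin : ∫⁻ z, ⨆ β ∈ S, ‖g z β‖ₑ ∂μ < ∞) :
    ∃ b : Z → ℝ, Integrable b μ ∧ ∀ᵐ z ∂μ, ∀ β ∈ S, ‖g z β‖ ≤ b z := by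
  have hmeas := aemeasurable_biSup_enorm hc hm
  refine ⟨fun z => (⨆ β ∈ S, ‖g z β‖ₑ).toReal,
    integrable_toReal_of_lintegral_ne_top hmeas hfin.ne, ?_⟩
  filter_upwards [ae_lt_top' hmeas hfin.ne] with z hz β hβ
  rw [← toReal_enorm]
  exact ENNReal.toReal_mono hz.ne (le_iSup₂ (f := fun b (_ : b ∈ S) => ‖g z b‖ₑ) β hβ)

/-- If `∫ f(z, β) dμ(z)` does not depend on `β`, then the derivative integrates to zero. -/
theorem integral_fderiv_eq_zero {f : Z → EuclideanSpace ℝ ι → F}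
    {U : Set (EuclideanSpace ℝ ι)} (hU : IsOpen U)
    (hm : ∀ β ∈ U, AEStronglyMeasurable (fun z => f z β) μ)
    (hd : ∀ᵐ z ∂μ, ContDiffOn ℝ 1 (f z) U)
    (hfin : ∫⁻ z, ⨆ β ∈ U, ‖fderiv ℝ (f z) β‖ₑ ∂μ < ∞)
    (hint : ∀ β ∈ U, Integrable (fun z => f z β) μ) {c : F}
    (hc : ∀ β ∈ U, ∫ z, f z β ∂μ = c) {β : EuclideanSpace ℝ ι} (hβ : β ∈ U) :
    Integrable (fun z => fderiv ℝ (f z) β) μ ∧ ∫ z, fderiv ℝ (f z) β ∂μ = 0 := by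
  have hm' := aestronglyMeasurable_fderiv hU hm
    (hd.mono fun z hz => hz.differentiableOn one_ne_zero)
  obtain ⟨b, hb, hbd⟩ := exists_integrable_bound
    (hd.mono fun z hz => hz.continuousOn_fderiv_of_isOpen hU le_rfl) hm' hfin
  refine ⟨hb.mono' (hm' β hβ) (hbd.mono fun z hz => hz β hβ), ?_⟩
  have h := hasFDerivAt_integral_of_dominated_of_fderiv_le (F := fun β z => f z β)
    (F' := fun β z => fderiv ℝ (f z) β) (hU.mem_nhds hβ)
    (eventually_of_mem (hU.mem_nhds hβ) hm) (hint β hβ) (hm' β hβ) hbd hb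
    (hd.mono fun z hz b hb =>
      ((hz.differentiableOn one_ne_zero b hb).differentiableAt (hU.mem_nhds hb)).hasFDerivAt)
  have h0 : HasFDerivAt (fun β => ∫ z, f z β ∂μ) (0 : EuclideanSpace ℝ ι →L[ℝ] F) β :=
    (hasFDerivAt_const c β).congr_of_eventuallyEq (eventually_of_mem (hU.mem_nhds hβ) hc)
  exact h.unique h0

/-- The norm of a multilinear form is at most the sum of the moduli of its coordinates. -/
theorem norm_multilinear_le_sum {n : ℕ}
    (f : ContinuousMultilinearMap ℝ (fun _ : Fin n => EuclideanSpace ℝ ι) F) :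
    ‖f‖ ≤ ∑ r : Fin n → ι, ‖f fun i => EuclideanSpace.single (r i) 1‖ := by
  refine f.opNorm_le_bound (Finset.sum_nonneg fun _ _ => norm_nonneg _) fun m => ?_
  have hm : m = fun i => ∑ a, (m i a) • EuclideanSpace.single a (1 : ℝ) := by
    funext i
    conv_lhs => rw [← (EuclideanSpace.basisFun ι ℝ).sum_repr (m i)]
    simp
  conv_lhs => rw [hm, ContinuousMultilinearMap.map_sum]
  rw [Finset.sum_mul]
  refine norm_sum_le_of_le _ fun r _ => ?_
  rw [ContinuousMultilinearMap.map_smul_univ, norm_smul, mul_comm, norm_prod]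
  gcongr with i
  exact PiLp.norm_apply_le (m i) (r i)

end Param

/-! ### Maxima of uniformly convergent functions -/

/-- Outside a neighbourhood of `β₀`, compactness leaves a positive gap below `L β₀`. Uniform errors
under half this gap keep `b n` from staying outside. -/
theorem tendsto_of_isMaxOn_of_tendstoUniformlyOn {E : Type*} [TopologicalSpace E]
    {B : Set E} (hB : IsCompact B) {G : ℕ → E → ℝ} {L : E → ℝ} {β₀ : E}
    (hG : TendstoUniformlyOn G L atTop B) (hL : ContinuousOn L B) (hβ₀ : β₀ ∈ B)
    (hmax : ∀ β ∈ B, β ≠ β₀ → L β < L β₀) {b : ℕ → E} (hbB : ∀ n, b n ∈ B)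
    (hb : ∀ n, G n β₀ ≤ G n (b n)) : Tendsto b atTop (𝓝 β₀) := by
  refine tendsto_nhds.2 fun U hU hβU => ?_
  change ∀ᶠ n in atTop, b n ∈ U
  rcases (B \ U).eq_empty_or_nonempty with h | h
  · exact Eventually.of_forall fun n => by_contra fun hn =>
      (h.subset ⟨hbB n, hn⟩ : b n ∈ (∅ : Set E))
  obtain ⟨β₁, hβ₁, hβ₁max⟩ := (hB.diff hU).exists_isMaxOn h (hL.mono Set.sdiff_subset)
  have hlt := hmax β₁ hβ₁.1 fun h => hβ₁.2 (h ▸ hβU)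
  filter_upwards [Metric.tendstoUniformlyOn_iff.1 hG ((L β₀ - L β₁) / 2) (by linarith)] with n hn
  by_contra hbn
  have h1 := abs_lt.1 (Real.dist_eq _ _ ▸ hn _ hβ₀)
  have h2 := abs_lt.1 (Real.dist_eq _ _ ▸ hn _ (hbB n))
  have h3 : L (b n) ≤ L β₁ := hβ₁max ⟨hbB n, hbn⟩
  linarith [hb n, h1.1, h1.2, h2.1, h2.2]

/-! ### Laws of large numbers -/

section LLN

variable {Z : Type*} [MeasurableSpace Z] {μ : Measure Z} {Ω : Type*} [MeasurableSpace Ω]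
  {P : Measure Ω} {X : ℕ → Ω → Z}

theorem ae_forall_obs (hX : ∀ i, HasLaw (X i) μ P) {p : Z → Prop} (h : ∀ᵐ z ∂μ, p z) :
    ∀ᵐ ω ∂P, ∀ i, p (X i ω) := ae_all_iff.2 fun i =>
  ae_of_ae_map (hX i).aemeasurable (p := p) ((hX i).map_eq.symm ▸ h)

theorem ae_tendsto_average {V : Type*} [NormedAddCommGroup V] [NormedSpace ℝ V] [CompleteSpace V]
    (hX : ∀ i, HasLaw (X i) μ P) (hindep : iIndepFun X P) {g : Z → V} (hg : Integrable g μ) :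
    ∀ᵐ ω ∂P, Tendsto (fun n : ℕ => (n : ℝ)⁻¹ • ∑ i ∈ Finset.range n, g (X i ω)) atTop
      (𝓝 (∫ z, g z ∂μ)) := by
  borelize V
  -- A measurable version is needed for independence and equality in law to pass to the composition;
  -- it agrees with `g` at all observations simultaneously, almost surely.
  set g' := hg.1.mk g
  have hmeas : Measurable g' := hg.1.stronglyMeasurable_mk.measurable
  have hgg : ∀ᵐ ω ∂P, ∀ i, g (X i ω) = g' (X i ω) := ae_forall_obs hX hg.1.ae_eq_mk
  have hint : Integrable g' μ := hg.congr hg.1.ae_eq_mk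
  have hlaw : ∀ i, IdentDistrib (g' ∘ X i) (g' ∘ X 0) P P := fun i =>
    IdentDistrib.comp ⟨(hX i).aemeasurable, (hX 0).aemeasurable,
      (hX i).map_eq.trans (hX 0).map_eq.symm⟩ hmeas
  have hint0 : Integrable (g' ∘ X 0) P := by
    have h := hint
    rw [← (hX 0).map_eq] at h
    exact h.comp_aemeasurable (hX 0).aemeasurable
  have h := strong_law_ae (fun i => g' ∘ X i) hint0
    (fun i j hij => (hindep.comp (fun _ => g') fun _ => hmeas).indepFun hij) hlaw
  have hE : ∫ ω, (g' ∘ X 0) ω ∂P = ∫ z, g z ∂μ := by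
    rw [(hX 0).integral_comp hint.1]
    exact (integral_congr_ae hg.1.ae_eq_mk).symm
  filter_upwards [h, hgg] with ω hω hω'
  rw [hE] at hω
  simpa only [hω', Function.comp_apply] using hω

/-- A closed ball is cut out by conditions at countably many points of a dense subset of `K`, and
separability of `C(K, ℝ)` makes every open set a countable union of closed balls. -/
theorem measurable_continuousMap {K : Type*} [TopologicalSpace K] [CompactSpace K]
    [TopologicalSpace.SeparableSpace K] [SecondCountableTopology C(K, ℝ)]
    [MeasurableSpace C(K, ℝ)] [BorelSpace C(K, ℝ)] {g : Z → C(K, ℝ)}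
    (hg : ∀ x, Measurable fun z => g z x) : Measurable g := by
  have hball : ∀ (c : C(K, ℝ)) (r : ℝ), 0 ≤ r → MeasurableSet (g ⁻¹' Metric.closedBall c r) := by
    intro c r hr
    obtain ⟨D, hD, hDd⟩ := TopologicalSpace.exists_countable_dense K
    have : g ⁻¹' Metric.closedBall c r = ⋂ x ∈ D, {z | |g z x - c x| ≤ r} := by
      ext z
      simp only [Set.mem_preimage, Metric.mem_closedBall, ContinuousMap.dist_le hr, Set.mem_iInter,
        Set.mem_ofPred_eq, Real.dist_eq]
      refine ⟨fun h x _ => h x, fun h x => ?_⟩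
      have hcl : IsClosed {x | |g z x - c x| ≤ r} :=
        isClosed_le (by fun_prop) continuous_const
      exact hcl.closure_subset_iff.2 h (hDd x)
    rw [this]
    exact MeasurableSet.biInter hD fun x _ =>
      measurableSet_le (measurable_abs.comp ((hg x).sub_const _)) measurable_const
  refine measurable_of_isOpen fun U hU => ?_
  obtain ⟨T, hT, hTd⟩ := TopologicalSpace.exists_countable_dense C(K, ℝ)
  have hU' : U = ⋃ c ∈ T, ⋃ q : {q : ℚ // 0 ≤ (q : ℝ) ∧ Metric.closedBall c (q : ℝ) ⊆ U},
      Metric.closedBall c (q.1 : ℝ) := by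
    ext f
    simp only [Set.mem_iUnion, exists_prop, Subtype.exists]
    constructor
    · intro hf
      obtain ⟨ε, hε, hεU⟩ := Metric.isOpen_iff.1 hU f hf
      obtain ⟨c, hcT, hc⟩ := hTd.exists_dist_lt f (show 0 < ε / 4 by positivity)
      -- As `dist f c < ε/4`, a radius `q > ε/4` captures `f`, while `q + ε/4 < ε` keeps the ball
      -- inside `U`.
      obtain ⟨q, hq1, hq2⟩ := exists_rat_btwn (show ε / 4 < ε / 2 by linarith)
      refine ⟨c, hcT, q, ⟨by linarith, fun f' hf' => hεU ?_⟩, ?_⟩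
      · have := dist_triangle f' c f
        have h1 : dist f' c ≤ q := hf'
        rw [dist_comm] at hc
        exact Metric.mem_ball.2 (by linarith)
      · exact Metric.mem_closedBall.2 (by linarith)
    · rintro ⟨c, -, q, ⟨-, hq⟩, hf⟩
      exact hq hf
  rw [hU']
  simp only [Set.preimage_iUnion]
  exact MeasurableSet.biUnion hT fun c _ => MeasurableSet.iUnion fun q => hball c _ q.2.1

/-- Uniform strong law of large numbers over a compact set. -/
theorem ae_tendstoUniformlyOn_average {E : Type*} [MetricSpace E] [SecondCountableTopology E]
    (hX : ∀ i, HasLaw (X i) μ P) (hindep : iIndepFun X P) {B : Set E} (hB : IsCompact B)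
    {g : Z → E → ℝ} (hm : ∀ β ∈ B, Measurable fun z => g z β)
    (hc : ∀ᵐ z ∂μ, ContinuousOn (g z) B) {b : Z → ℝ} (hb : Integrable b μ)
    (hgb : ∀ᵐ z ∂μ, ∀ β ∈ B, |g z β| ≤ b z) :
    ContinuousOn (fun β => ∫ z, g z β ∂μ) B ∧
    ∀ᵐ ω ∂P, TendstoUniformlyOn (fun (n : ℕ) β => (n : ℝ)⁻¹ * ∑ i ∈ Finset.range n, g (X i ω) β)
      (fun β => ∫ z, g z β ∂μ) atTop B := by
  classical
  have : CompactSpace B := isCompact_iff_compactSpace.1 hB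
  borelize C(B, ℝ)
  obtain ⟨S, hS, hSm, hSc⟩ := hc.exists_measurable_mem
  -- Each observation becomes a random element of the Banach space `C(B, ℝ)`, where norm convergence
  -- is uniform convergence on `B`. The value `0` is used only off the full-measure set `S`.
  let G : Z → C(B, ℝ) := fun z =>
    if h : z ∈ S then ⟨B.domRestrict (g z), (hSc z h).domRestrict⟩ else 0
  have hGapp : ∀ z ∈ S, ∀ x : B, G z x = g z x := fun z hz x => by
    simp only [G, dif_pos hz]; rfl
  have hGm : Measurable G := measurable_continuousMap fun x => by
    have : (fun z => G z x) = S.indicator fun z => g z x := by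
      funext z
      by_cases hz : z ∈ S
      · rw [hGapp z hz, Set.indicator_of_mem hz]
      · simp [G, hz]
    rw [this]
    exact (hm x x.2).indicator hSm
  have hGint : Integrable G μ := by
    refine hb.abs.mono' hGm.aestronglyMeasurable ?_
    filter_upwards [hS, hgb] with z hz hzb
    refine (ContinuousMap.norm_le _ (abs_nonneg _)).2 fun y => ?_
    rw [hGapp z hz, Real.norm_eq_abs]
    exact (hzb y y.2).trans (le_abs_self _)
  have hev : ∀ x : B, (∫ z, G z ∂μ) x = ∫ z, g z x ∂μ := fun x => by
    have h := (ContinuousMap.evalCLM ℝ x).integral_comp_comm hGint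
    rw [ContinuousMap.evalCLM_apply] at h
    rw [← h]
    refine integral_congr_ae ?_
    filter_upwards [hS] with z hz
    exact hGapp z hz x
  refine ⟨?_, ?_⟩
  · rw [continuousOn_iff_continuous_domRestrict]
    convert (∫ z, G z ∂μ).continuous using 1
    funext x
    exact (hev x).symm
  · have hSX : ∀ᵐ ω ∂P, ∀ i, X i ω ∈ S := ae_forall_obs hX hS
    filter_upwards [ae_tendsto_average hX hindep hGint, hSX] with ω hω hωS
    rw [ContinuousMap.tendsto_iff_tendstoUniformly, Metric.tendstoUniformly_iff] at hω
    refine Metric.tendstoUniformlyOn_iff.2 fun ε hε => (hω ε hε).mono fun n hn β hβ => ?_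
    have h := hn ⟨β, hβ⟩
    rw [hev] at h
    simpa [ContinuousMap.sum_apply, hGapp _ (hωS _)] using h

end LLN

/-! ### The multivariate central limit theorem -/

section CLT

variable {Z : Type*} [MeasurableSpace Z] {μ : Measure Z} {Ω : Type*} [MeasurableSpace Ω]
  {P : Measure Ω} [IsProbabilityMeasure P] {X : ℕ → Ω → Z} {ι : Type*} [Fintype ι] [DecidableEq ι]

/-- Cramér–Wold: the characteristic function at `t` of the normalized vector sum is the
characteristic function at `1` of the normalized real sum of `⟨t, Y⟩`, to which the one-dimensional
theorem applies. -/
theorem tendstoInDistribution_clt (hX : ∀ i, HasLaw (X i) μ P) (hindep : iIndepFun X P)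
    {Y : Z → EuclideanSpace ℝ ι} (hY : MemLp Y 2 μ) (h0 : ∫ z, Y z ∂μ = 0) {V : Matrix ι ι ℝ}
    (hV : V.PosSemidef)
    (hcov : ∀ t : EuclideanSpace ℝ ι,
      ∫ z, inner ℝ t (Y z) ^ 2 ∂μ = WithLp.ofLp t ⬝ᵥ V *ᵥ WithLp.ofLp t) :
    TendstoInDistribution (fun (n : ℕ) ω => (Real.sqrt n)⁻¹ • ∑ i ∈ Finset.range n, Y (X i ω)) atTop
      id (fun _ => P) (multivariateGaussian 0 V) := by
  have hμ : IsProbabilityMeasure μ := by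
    rw [← (hX 0).map_eq]; exact Measure.isProbabilityMeasure_map (hX 0).aemeasurable
  set Y' := hY.1.mk Y
  have hmeas : Measurable Y' := hY.1.stronglyMeasurable_mk.measurable
  have hYY : Y =ᵐ[μ] Y' := hY.1.ae_eq_mk
  have hXY : ∀ᵐ ω ∂P, ∀ i, Y (X i ω) = Y' (X i ω) := ae_forall_obs hX hYY
  have hY'L : MemLp Y' 2 μ := hY.ae_eq hYY
  have hY'm : ∀ i, AEMeasurable (fun ω => Y' (X i ω)) P := fun i =>
    hmeas.comp_aemeasurable (hX i).aemeasurable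
  have hSm : ∀ n : ℕ, AEMeasurable
      (fun ω => (Real.sqrt n)⁻¹ • ∑ i ∈ Finset.range n, Y' (X i ω)) P := fun n =>
    AEMeasurable.fun_const_smul (Finset.aemeasurable_fun_sum _ fun i _ => hY'm i) _
  suffices h : TendstoInDistribution
      (fun (n : ℕ) ω => (Real.sqrt n)⁻¹ • ∑ i ∈ Finset.range n, Y' (X i ω)) atTop
      id (fun _ => P) (multivariateGaussian 0 V) by
    refine h.congr (fun n => ?_) EventuallyEq.rfl
    filter_upwards [hXY] with ω hω
    simp only [hω]
  refine ⟨hSm, by fun_prop, ?_⟩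
  refine ProbabilityMeasure.tendsto_iff_tendsto_charFun.2 fun t => ?_
  -- reduction to the linear functional `⟨t, ·⟩`
  set ξ : ℕ → Ω → ℝ := fun i ω => inner ℝ t (Y' (X i ω))
  have hu : Measurable fun z => inner ℝ t (Y' z) := measurable_const.inner hmeas
  have huL : MemLp (fun z => inner ℝ t (Y' z)) 2 μ := hY'L.const_inner t
  have hξi : iIndepFun ξ P := hindep.comp (fun _ z => inner ℝ t (Y' z)) fun _ => hu
  have hξd : ∀ i, IdentDistrib (ξ i) (ξ 0) P P := fun i =>
    IdentDistrib.comp (f := X i) (g := X 0) ⟨(hX i).aemeasurable, (hX 0).aemeasurable,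
      (hX i).map_eq.trans (hX 0).map_eq.symm⟩ hu
  have hξL : MemLp (ξ 0) 2 P := by
    have h := huL
    rw [← (hX 0).map_eq] at h
    exact h.comp_of_map (hX 0).aemeasurable
  have hmean : P[ξ 0] = 0 := by
    have h1 : P[ξ 0] = ∫ z, inner ℝ t (Y' z) ∂μ := (hX 0).integral_comp hu.aestronglyMeasurable
    rw [h1, integral_inner (hY'L.integrable one_le_two), ← integral_congr_ae hYY, h0,
      inner_zero_right]
  have hvar : Var[ξ 0; P] = WithLp.ofLp t ⬝ᵥ V *ᵥ WithLp.ofLp t := by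
    rw [variance_eq_sub hξL, hmean, ← hcov t]
    have h1 : ∫ ω, ξ 0 ω ^ 2 ∂P = ∫ z, inner ℝ t (Y' z) ^ 2 ∂μ :=
      (hX 0).integral_comp (f := fun z => inner ℝ t (Y' z) ^ 2)
        (hu.pow_const 2).aestronglyMeasurable
    simp only [Pi.pow_apply, h1, ne_eq, OfNat.ofNat_ne_zero, not_false_eq_true, zero_pow, sub_zero]
    refine integral_congr_ae ?_
    filter_upwards [hYY] with z hz
    rw [hz]
  have hclt := tendstoInDistribution_inv_sqrt_mul_sum_sub (P := P)
    (P' := gaussianReal 0 Var[ξ 0; P].toNNReal) (Y := id) HasLaw.id hξL hξi hξd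
  have hone := ProbabilityMeasure.tendsto_iff_tendsto_charFun.1 hclt.tendsto 1
  have hlim : charFun (multivariateGaussian 0 V) t
      = charFun (gaussianReal 0 Var[ξ 0; P].toNNReal) 1 := by
    rw [charFun_multivariateGaussian hV, charFun_gaussianReal,
      Real.coe_toNNReal _ (variance_nonneg _ _), hvar]
    simp
  simp only [ProbabilityMeasure.coe_mk, Measure.map_id] at hone ⊢
  rw [hlim]
  refine hone.congr fun n => ?_
  rw [charFun_apply, charFun_apply, integral_map (hclt.forall_aemeasurable n) (by fun_prop),
    integral_map (hSm n) (by fun_prop)]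
  refine integral_congr_ae (Eventually.of_forall fun ω => ?_)
  have hi : (inner ℝ ((Real.sqrt n)⁻¹ • ∑ i ∈ Finset.range n, Y' (X i ω)) t : ℝ)
      = (Real.sqrt n)⁻¹ * ∑ i ∈ Finset.range n, ξ i ω := by
    rw [real_inner_smul_left, real_inner_comm, inner_sum]
  simp only [hi, hmean]
  simp

end CLT

/-! ### Tightness, and from relative to absolute error in probability -/

section Tight

variable {Ω Ω' : Type*} [MeasurableSpace Ω] {P : Measure Ω} [IsProbabilityMeasure P]
  [MeasurableSpace Ω'] {P' : Measure Ω'} [IsProbabilityMeasure P']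
  {E : Type*} [NormedAddCommGroup E] [InnerProductSpace ℝ E] [FiniteDimensional ℝ E]
  [MeasurableSpace E] [BorelSpace E] {T W : ℕ → Ω → E} {V : Ω' → E}

/-- The characteristic functions converge to one that is continuous at the origin, which forces
tightness; one bound then serves every `n`. -/
theorem exists_norm_bound_of_tendstoInDistribution
    (h : TendstoInDistribution W atTop V (fun _ => P) P') {ε : ℝ≥0∞} (hε : 0 < ε) :
    ∃ C : ℝ, 0 ≤ C ∧ ∀ n, P {ω | C < ‖W n ω‖} ≤ ε := by
  have hp : ∀ n, IsProbabilityMeasure (P.map (W n)) := fun n =>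
    Measure.isProbabilityMeasure_map (h.forall_aemeasurable n)
  have ht := isTightMeasureSet_of_tendsto_charFun (μ := fun n => P.map (W n))
    (f := charFun (P'.map V))
    (by
      have := Measure.isProbabilityMeasure_map (μ := P') h.aemeasurable_limit
      exact continuous_charFun.continuousAt)
    (ProbabilityMeasure.tendsto_iff_tendsto_charFun.1 h.tendsto)
  rw [isTightMeasureSet_iff_tendsto_measure_norm_gt] at ht
  obtain ⟨C, hC, hC0⟩ :=
    ((ENNReal.tendsto_nhds_zero.1 ht ε hε).and (eventually_ge_atTop 0)).exists
  refine ⟨C, hC0, fun n => ?_⟩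
  have h1 : P.map (W n) {x | C < ‖x‖} ≤ ε :=
    (le_iSup₂ (f := fun (μ : Measure E) (_ : μ ∈ Set.range fun n => P.map (W n)) =>
      μ {x | C < ‖x‖}) _ ⟨n, rfl⟩).trans hC
  rwa [Measure.map_apply_of_aemeasurable (h.forall_aemeasurable n)
    (measurableSet_lt measurable_const measurable_norm)] at h1

/-- Pathwise, `W` may be unbounded, so the almost sure hypothesis controls only the error relative
to `1 + ‖W‖`. Tightness removes this factor outside an event of small probability. -/
theorem tendstoInMeasure_sub_of_ae (hT : ∀ n, AEMeasurable (T n) P) (hW : ∀ n, AEMeasurable (W n) P)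
    (htight : ∀ ε : ℝ≥0∞, 0 < ε → ∃ C : ℝ, 0 ≤ C ∧ ∀ n, P {ω | C < ‖W n ω‖} ≤ ε)
    (hae : ∀ᵐ ω ∂P, Tendsto (fun n => (1 + ‖W n ω‖)⁻¹ * ‖T n ω - W n ω‖) atTop (𝓝 0)) :
    TendstoInMeasure P (T - W) atTop 0 := by
  have hQ : TendstoInMeasure P (fun n ω => (1 + ‖W n ω‖)⁻¹ * ‖T n ω - W n ω‖) atTop fun _ => 0 :=
    tendstoInMeasure_of_tendsto_ae (fun n => by
      have := hT n; have := hW n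
      exact AEMeasurable.aestronglyMeasurable (by fun_prop)) hae
  rw [tendstoInMeasure_iff_norm] at hQ ⊢
  intro η hη
  refine ENNReal.tendsto_nhds_zero.2 fun ε hε => ?_
  obtain ⟨C, hC0, hC⟩ := htight (ε / 2) (ENNReal.half_pos hε.ne')
  -- Where `‖W n‖ ≤ C`, an error of at least `η` has relative size at least `η / (1 + C)`.
  filter_upwards [ENNReal.tendsto_nhds_zero.1 (hQ (η / (1 + C)) (by positivity)) (ε / 2)
    (ENNReal.half_pos hε.ne')] with n hn
  refine (measure_mono (t := {ω | C < ‖W n ω‖} ∪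
    {ω | η / (1 + C) ≤ ‖(1 + ‖W n ω‖)⁻¹ * ‖T n ω - W n ω‖ - 0‖}) fun ω hω => ?_).trans
    ((measure_union_le _ _).trans ((add_le_add (hC n) hn).trans (ENNReal.add_halves ε).le))
  by_cases h : C < ‖W n ω‖
  · exact Or.inl h
  · refine Or.inr ?_
    have hω' : η ≤ ‖T n ω - W n ω‖ := by simpa using hω
    have hpos : (0 : ℝ) < 1 + ‖W n ω‖ := by positivity
    change η / (1 + C) ≤ ‖(1 + ‖W n ω‖)⁻¹ * ‖T n ω - W n ω‖ - 0‖
    rw [sub_zero, Real.norm_of_nonneg (by positivity), inv_mul_eq_div]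
    have := not_lt.1 h
    gcongr

end Tight

/-! ### Linearization of the score equation -/

section Score

variable {E : Type*} [NormedAddCommGroup E] [NormedSpace ℝ E]

theorem norm_fderiv_sub_linear_le {f : E → ℝ} {β₀ b : E} {ρ K : ℝ}
    (hf : ContDiffOn ℝ 3 f (Metric.ball β₀ ρ))
    (hK : ∀ β ∈ Metric.ball β₀ ρ, ‖iteratedFDeriv ℝ 3 f β‖ ≤ K) (hb : b ∈ Metric.ball β₀ ρ) :
    ‖fderiv ℝ f b - fderiv ℝ f β₀ - fderiv ℝ (fderiv ℝ f) β₀ (b - β₀)‖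
      ≤ K * ‖b - β₀‖ * ‖b - β₀‖ := by
  have hO : IsOpen (Metric.ball β₀ ρ) := Metric.isOpen_ball
  have hρ : 0 < ρ := Metric.pos_of_mem_ball hb
  have h0 : β₀ ∈ Metric.ball β₀ ρ := Metric.mem_ball_self hρ
  have hf1 : ContDiffOn ℝ 2 (fderiv ℝ f) (Metric.ball β₀ ρ) :=
    hf.fderiv_of_isOpen hO (by norm_num)
  have hf2 : ContDiffOn ℝ 1 (fderiv ℝ (fderiv ℝ f)) (Metric.ball β₀ ρ) :=
    hf1.fderiv_of_isOpen hO (by norm_num)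
  have hd2 : ∀ x ∈ Metric.ball β₀ ρ, HasFDerivAt (fderiv ℝ f) (fderiv ℝ (fderiv ℝ f) x) x :=
    fun x hx => ((hf1.differentiableOn two_ne_zero x hx).differentiableAt
      (hO.mem_nhds hx)).hasFDerivAt
  have hd3 : ∀ x ∈ Metric.ball β₀ ρ, HasFDerivAt (fderiv ℝ (fderiv ℝ f))
      (fderiv ℝ (fderiv ℝ (fderiv ℝ f)) x) x :=
    fun x hx => ((hf2.differentiableOn one_ne_zero x hx).differentiableAt
      (hO.mem_nhds hx)).hasFDerivAt
  have hnorm : ∀ x ∈ Metric.ball β₀ ρ, ‖fderiv ℝ (fderiv ℝ (fderiv ℝ f)) x‖ ≤ K := fun x hx => by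
    rw [← norm_iteratedFDeriv_one, norm_iteratedFDeriv_fderiv, norm_iteratedFDeriv_fderiv]
    exact hK x hx
  have hlip : ∀ x ∈ Metric.ball β₀ ρ,
      ‖fderiv ℝ (fderiv ℝ f) x - fderiv ℝ (fderiv ℝ f) β₀‖ ≤ K * ‖x - β₀‖ := fun x hx =>
    (convex_ball β₀ ρ).norm_image_sub_le_of_norm_hasFDerivWithin_le
      (fun y hy => (hd3 y hy).hasFDerivWithinAt) hnorm h0 hx
  have hK0 : 0 ≤ K := (norm_nonneg _).trans (hK β₀ h0)
  have hsub : Metric.closedBall β₀ ‖b - β₀‖ ⊆ Metric.ball β₀ ρ :=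
    Metric.closedBall_subset_ball (by simpa [dist_eq_norm] using hb)
  -- Second use of the mean value inequality, on the closed ball through `b`: there the Lipschitz
  -- bound on the second derivative is at most `K * ‖b - β₀‖`.
  refine Convex.norm_image_sub_le_of_norm_hasFDerivWithin_le'
    (s := Metric.closedBall β₀ ‖b - β₀‖)
    (fun x hx => (hd2 x (hsub hx)).hasFDerivWithinAt) (fun x hx => ?_) (convex_closedBall _ _)
    (Metric.mem_closedBall_self (norm_nonneg _)) (by simp [dist_eq_norm])
  refine (hlip x (hsub hx)).trans ?_
  gcongr
  simpa [dist_eq_norm] using hx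

/-- The score equation at `b` is inserted into the expansion about `β₀`. The three error terms are
the deviation of the Hessian from `-n J`, the Taylor remainder and the penalty gradient. -/
theorem norm_linearized_score_le {n : ℕ} {ℓ : ℕ → E → ℝ} {Q : E → ℝ} {β₀ b : E} {ρ : ℝ}
    {K : ℕ → ℝ} (hℓ : ∀ i, ContDiffOn ℝ 3 (ℓ i) (Metric.ball β₀ ρ))
    (hK : ∀ i, ∀ β ∈ Metric.ball β₀ ρ, ‖iteratedFDeriv ℝ 3 (ℓ i) β‖ ≤ K i)
    (hb : b ∈ Metric.ball β₀ ρ) (hQ : DifferentiableAt ℝ Q b)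
    (hmax : ∀ β ∈ Metric.ball β₀ ρ, ∑ i ∈ Finset.range n, ℓ i β - Q β
      ≤ ∑ i ∈ Finset.range n, ℓ i b - Q b)
    (J : E →L[ℝ] E →L[ℝ] ℝ) :
    ‖(n : ℝ) • J (b - β₀) - ∑ i ∈ Finset.range n, fderiv ℝ (ℓ i) β₀‖
      ≤ ‖(n : ℝ) • J + ∑ i ∈ Finset.range n, fderiv ℝ (fderiv ℝ (ℓ i)) β₀‖ * ‖b - β₀‖
        + (∑ i ∈ Finset.range n, K i) * ‖b - β₀‖ * ‖b - β₀‖ + ‖fderiv ℝ Q b‖ := by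
  have hnhds : Metric.ball β₀ ρ ∈ 𝓝 b := Metric.isOpen_ball.mem_nhds hb
  have hd : ∀ i, DifferentiableAt ℝ (ℓ i) b := fun i =>
    ((hℓ i).differentiableOn three_ne_zero b hb).differentiableAt hnhds
  -- The open ball is a neighbourhood of `b`, so maximality on it yields a vanishing derivative.
  have hcrit : ∑ i ∈ Finset.range n, fderiv ℝ (ℓ i) b = fderiv ℝ Q b := by
    have hder := (HasFDerivAt.fun_sum (u := Finset.range n) fun i _ => (hd i).hasFDerivAt).sub
      hQ.hasFDerivAt
    have hloc : IsLocalMax (fun β => ∑ i ∈ Finset.range n, ℓ i β - Q β) b := by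
      filter_upwards [hnhds] with β hβ using hmax β hβ
    exact sub_eq_zero.1 (hloc.hasFDerivAt_eq_zero hder)
  have htaylor : ‖∑ i ∈ Finset.range n, (fderiv ℝ (ℓ i) b - fderiv ℝ (ℓ i) β₀
      - fderiv ℝ (fderiv ℝ (ℓ i)) β₀ (b - β₀))‖
      ≤ (∑ i ∈ Finset.range n, K i) * ‖b - β₀‖ * ‖b - β₀‖ := by
    rw [Finset.sum_mul, Finset.sum_mul]
    exact norm_sum_le_of_le _ fun i _ => norm_fderiv_sub_linear_le (hℓ i) (hK i) hb
  have hsplit : (n : ℝ) • J (b - β₀) - ∑ i ∈ Finset.range n, fderiv ℝ (ℓ i) β₀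
      = ((n : ℝ) • J + ∑ i ∈ Finset.range n, fderiv ℝ (fderiv ℝ (ℓ i)) β₀) (b - β₀)
        + ∑ i ∈ Finset.range n, (fderiv ℝ (ℓ i) b - fderiv ℝ (ℓ i) β₀
          - fderiv ℝ (fderiv ℝ (ℓ i)) β₀ (b - β₀)) - fderiv ℝ Q b := by
    rw [Finset.sum_sub_distrib, Finset.sum_sub_distrib, hcrit]
    simp only [add_apply, smul_apply, sum_apply]
    abel
  rw [hsplit]
  refine (norm_sub_le _ _).trans (add_le_add_left ((norm_add_le _ _).trans
    (add_le_add (ContinuousLinearMap.le_opNorm _ _) htaylor)) _)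

end Score

/-! ### Penalized M-estimators -/

section MEstimator

variable {E : Type*} [NormedAddCommGroup E]

/-- Along a consistent sequence of interior maximizers, the estimation error is asymptotically
linear in the score. -/
theorem tendsto_relative_error [NormedSpace ℝ E] {ℓ : ℕ → E → ℝ} {Q : ℕ → E → ℝ} {β₀ : E}
    {ρ : ℝ} (hρ : 0 < ρ) {K : ℕ → ℝ} {b : ℕ → E} {c : ℕ → ℝ} {k : ℝ}
    {J : E →L[ℝ] E →L[ℝ] ℝ} {J' : (E →L[ℝ] ℝ) →L[ℝ] E}
    (hJ' : ∀ v, J' (J v) = v)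
    (hℓ : ∀ i, ContDiffOn ℝ 3 (ℓ i) (Metric.ball β₀ ρ))
    (hK : ∀ i, ∀ β ∈ Metric.ball β₀ ρ, ‖iteratedFDeriv ℝ 3 (ℓ i) β‖ ≤ K i)
    (hKlim : Tendsto (fun n : ℕ => (n : ℝ)⁻¹ • ∑ i ∈ Finset.range n, K i) atTop (𝓝 k))
    (hHlim : Tendsto (fun n : ℕ => (n : ℝ)⁻¹ • ∑ i ∈ Finset.range n,
      fderiv ℝ (fderiv ℝ (ℓ i)) β₀) atTop (𝓝 (-J)))
    (hQ : ∀ n, Differentiable ℝ (Q n)) (hc : Tendsto c atTop (𝓝 0))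
    (hQc : ∀ n, ‖fderiv ℝ (Q n) (b n)‖ ≤ c n)
    (hmax : ∀ n, ∀ β ∈ Metric.ball β₀ ρ, ∑ i ∈ Finset.range n, ℓ i β - Q n β
      ≤ ∑ i ∈ Finset.range n, ℓ i (b n) - Q n (b n))
    (hb : Tendsto b atTop (𝓝 β₀)) :
    Tendsto (fun n : ℕ => (1 + ‖(Real.sqrt n)⁻¹ • ∑ i ∈ Finset.range n, J' (fderiv ℝ (ℓ i) β₀)‖)⁻¹ *
      ‖Real.sqrt n • (b n - β₀)
        - (Real.sqrt n)⁻¹ • ∑ i ∈ Finset.range n, J' (fderiv ℝ (ℓ i) β₀)‖) atTop (𝓝 0) := by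
  set T : ℕ → E := fun n => Real.sqrt n • (b n - β₀) with hT
  set W : ℕ → E := fun n => (Real.sqrt n)⁻¹ • ∑ i ∈ Finset.range n, J' (fderiv ℝ (ℓ i) β₀) with hW
  -- This is the factor multiplying `‖T n‖` after the linearized equation is divided by `√n`;
  -- consistency sends its remainder part to zero.
  set ε : ℕ → ℝ := fun n => ‖J'‖ * (‖J + (n : ℝ)⁻¹ • ∑ i ∈ Finset.range n,
      fderiv ℝ (fderiv ℝ (ℓ i)) β₀‖
    + ((n : ℝ)⁻¹ • ∑ i ∈ Finset.range n, K i) * ‖b n - β₀‖) with hε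
  have hεlim : Tendsto ε atTop (𝓝 0) := by
    have h1 : Tendsto (fun n => ‖b n - β₀‖) atTop (𝓝 0) :=
      tendsto_iff_norm_sub_tendsto_zero.1 hb
    have h2 := ((tendsto_const_nhds (x := J)).add hHlim).norm
    have h3 := ((h2.add (hKlim.mul h1)).const_mul ‖J'‖)
    simpa [hε] using h3
  have hδlim : Tendsto (fun n => ‖J'‖ * c n) atTop (𝓝 0) := by simpa using hc.const_mul ‖J'‖
  have hmain : ∀ᶠ n in atTop, ‖T n - W n‖ ≤ ε n * ‖T n‖ + ‖J'‖ * c n := by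
    filter_upwards [hb.eventually (Metric.ball_mem_nhds β₀ hρ), eventually_ge_atTop 1] with n hbn hn
    have hn0 : (0 : ℝ) < n := by exact_mod_cast hn
    have hs : (1 : ℝ) ≤ Real.sqrt n := Real.one_le_sqrt.2 (by exact_mod_cast hn)
    have hs0 : 0 < Real.sqrt n := by linarith
    have hss : (Real.sqrt n)⁻¹ * (n : ℝ) = Real.sqrt n := by
      rw [inv_mul_eq_div, div_eq_iff hs0.ne', Real.mul_self_sqrt hn0.le]
    have hTn : ‖T n‖ = Real.sqrt n * ‖b n - β₀‖ := by
      rw [hT, norm_smul, Real.norm_of_nonneg hs0.le]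
    have hTW : T n - W n = (Real.sqrt n)⁻¹ •
        J' ((n : ℝ) • J (b n - β₀) - ∑ i ∈ Finset.range n, fderiv ℝ (ℓ i) β₀) := by
      rw [map_sub, map_smul, hJ', map_sum, smul_sub, smul_smul, hss]
    have hlin := norm_linearized_score_le hℓ hK hbn (hQ n (b n)) (hmax n) J
    have hHn : ‖(n : ℝ) • J + ∑ i ∈ Finset.range n, fderiv ℝ (fderiv ℝ (ℓ i)) β₀‖
        = n * ‖J + (n : ℝ)⁻¹ • ∑ i ∈ Finset.range n, fderiv ℝ (fderiv ℝ (ℓ i)) β₀‖ := by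
      rw [← norm_smul_of_nonneg hn0.le, smul_add,
        smul_inv_smul₀ hn0.ne']
    have hKn : ∑ i ∈ Finset.range n, K i = n * ((n : ℝ)⁻¹ • ∑ i ∈ Finset.range n, K i) := by
      rw [smul_eq_mul, mul_inv_cancel_left₀ hn0.ne']
    rw [hHn, hKn] at hlin
    have hc0 : 0 ≤ c n := (norm_nonneg _).trans (hQc n)
    calc ‖T n - W n‖ ≤ (Real.sqrt n)⁻¹ * (‖J'‖ *
          ‖(n : ℝ) • J (b n - β₀) - ∑ i ∈ Finset.range n, fderiv ℝ (ℓ i) β₀‖) := by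
          rw [hTW, norm_smul, Real.norm_of_nonneg (by positivity)]
          gcongr
          exact J'.le_opNorm _
      _ ≤ (Real.sqrt n)⁻¹ * (‖J'‖ * (n * ‖J + (n : ℝ)⁻¹ • ∑ i ∈ Finset.range n,
            fderiv ℝ (fderiv ℝ (ℓ i)) β₀‖ * ‖b n - β₀‖
          + n * ((n : ℝ)⁻¹ • ∑ i ∈ Finset.range n, K i) * ‖b n - β₀‖ * ‖b n - β₀‖ + c n)) := by
          gcongr
          exact hlin.trans (add_le_add_right (hQc n) _)
      _ = ((Real.sqrt n)⁻¹ * n) * ‖b n - β₀‖ * ε n + (Real.sqrt n)⁻¹ * (‖J'‖ * c n) := by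
          rw [hε]; ring
      _ ≤ ε n * ‖T n‖ + 1 * (‖J'‖ * c n) := by
          rw [hss, hTn, mul_comm (ε n)]
          gcongr
          exact inv_le_one_of_one_le₀ hs
      _ = _ := by rw [one_mul]
  -- Substituting `‖T‖ ≤ ‖W‖ + ‖T - W‖` into the main bound, the term `ε ‖T - W‖` is absorbed on the
  -- left once `ε ≤ 1/2`. This costs the factor `2`.
  refine squeeze_zero' (Eventually.of_forall fun n => by positivity) ?_
    (by simpa using (hεlim.add hδlim).const_mul 2)
  have hε2 := hεlim.eventually_le_const (show (0 : ℝ) < 1 / 2 by norm_num)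
  have hε0 : ∀ᶠ n in atTop, (0 : ℝ) ≤ ε n := Eventually.of_forall fun n => by
    have : ∀ i, 0 ≤ K i := fun i => (norm_nonneg _).trans (hK i β₀ (Metric.mem_ball_self hρ))
    have : 0 ≤ ∑ i ∈ Finset.range n, K i := Finset.sum_nonneg fun i _ => this i
    simp only [hε, smul_eq_mul]
    positivity
  filter_upwards [hmain, hε2, hε0] with n hn hn2 hn0
  have h1 : ‖T n‖ ≤ ‖W n‖ + ‖T n - W n‖ := by
    simpa using norm_add_le (W n) (T n - W n)
  have hc0 : 0 ≤ ‖J'‖ * c n := mul_nonneg (norm_nonneg _) ((norm_nonneg _).trans (hQc n))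
  have h2 : 0 ≤ ‖W n‖ := norm_nonneg _
  have h3 : 0 ≤ ‖T n - W n‖ := norm_nonneg _
  rw [inv_mul_le_iff₀ (by positivity)]
  nlinarith [mul_le_mul_of_nonneg_left h1 hn0, mul_le_mul_of_nonneg_right hn2 h3,
    mul_nonneg h2 hc0]

variable {Z : Type*} [MeasurableSpace Z] {μ : Measure Z} {Ω : Type*} [MeasurableSpace Ω]
  {P : Measure Ω} {X : ℕ → Ω → Z}

/-- Strong consistency of penalized M-estimators over a compact parameter set. -/
theorem ae_tendsto_penalized_maximizer [SecondCountableTopology E]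
    (hX : ∀ i, HasLaw (X i) μ P) (hindep : iIndepFun X P) {ℓ : Z → E → ℝ} {Q : ℕ → E → ℝ}
    {B : Set E} {β₀ : E} {c : ℕ → ℝ} (hB : IsCompact B) (hβ₀ : β₀ ∈ B)
    (hm : ∀ β ∈ B, Measurable fun z => ℓ z β) (hcont : ∀ᵐ z ∂μ, ContinuousOn (ℓ z) B)
    {M : Z → ℝ} (hM : Integrable M μ) (hℓM : ∀ᵐ z ∂μ, ∀ β ∈ B, |ℓ z β| ≤ M z)
    (hmax : ∀ β ∈ B, β ≠ β₀ → ∫ z, ℓ z β ∂μ < ∫ z, ℓ z β₀ ∂μ)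
    (hc : Tendsto c atTop (𝓝 0)) (hQc : ∀ n, ∀ β ∈ B, |Q n β| ≤ c n)
    {b : ℕ → Ω → E} (hbB : ∀ n, ∀ᵐ ω ∂P, b n ω ∈ B)
    (hb : ∀ n, ∀ᵐ ω ∂P, ∑ i ∈ Finset.range n, ℓ (X i ω) β₀ - Q n β₀
      ≤ ∑ i ∈ Finset.range n, ℓ (X i ω) (b n ω) - Q n (b n ω)) :
    ∀ᵐ ω ∂P, Tendsto (fun n => b n ω) atTop (𝓝 β₀) := by
  obtain ⟨hL, hunif⟩ := ae_tendstoUniformlyOn_average hX hindep hB hm hcont hM hℓM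
  filter_upwards [hunif, ae_all_iff.2 hbB, ae_all_iff.2 hb] with ω hω hωB hωb
  refine tendsto_of_isMaxOn_of_tendstoUniformlyOn hB
    (G := fun n β => (n : ℝ)⁻¹ * (∑ i ∈ Finset.range n, ℓ (X i ω) β - Q n β)) ?_ hL hβ₀ hmax hωB
    fun n => mul_le_mul_of_nonneg_left (hωb n) (by positivity)
  rw [Metric.tendstoUniformlyOn_iff] at hω ⊢
  intro ε hε
  filter_upwards [hω (ε / 2) (half_pos hε), hc.eventually_lt_const (half_pos hε),
    eventually_ge_atTop 1] with n hn hcn hn1 β hβ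
  have hn' : (1 : ℝ) ≤ n := by exact_mod_cast hn1
  have h1 := hn β hβ
  have h2 : |(n : ℝ)⁻¹ * Q n β| ≤ c n := by
    rw [abs_mul, abs_of_nonneg (by positivity)]
    exact (mul_le_of_le_one_left (abs_nonneg _) (inv_le_one_of_one_le₀ hn')).trans (hQc n β hβ)
  rw [Real.dist_eq] at h1 ⊢
  have h3 := abs_add_le (∫ z, ℓ z β ∂μ - (n : ℝ)⁻¹ * ∑ i ∈ Finset.range n, ℓ (X i ω) β)
    ((n : ℝ)⁻¹ * Q n β)
  rw [mul_sub, ← sub_add]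
  linarith

end MEstimator

/-! ### From the linearized score to the limit law -/

section Normality

variable {ι : Type*} [Fintype ι] [DecidableEq ι]
  {Z : Type*} [MeasurableSpace Z] {μ : Measure Z} {Ω : Type*} [MeasurableSpace Ω]
  {P : Measure Ω} [IsProbabilityMeasure P] {X : ℕ → Ω → Z}

/-- Root-`n` consistency and asymptotic normality of penalized M-estimators. -/
theorem penalized_maximizer_asymptotics
    (hX : ∀ i, HasLaw (X i) μ P) (hindep : iIndepFun X P)
    {ℓ : Z → EuclideanSpace ℝ ι → ℝ} {Q : ℕ → EuclideanSpace ℝ ι → ℝ}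
    {B B₀ : Set (EuclideanSpace ℝ ι)} {β₀ : EuclideanSpace ℝ ι} {c : ℕ → ℝ}
    (hB : IsCompact B) (hB₀ : IsOpen B₀) (hβ₀ : β₀ ∈ B₀) (hsub : B₀ ⊆ B)
    (hm : ∀ β ∈ B, Measurable fun z => ℓ z β) (hcont : ∀ᵐ z ∂μ, ContinuousOn (ℓ z) B)
    {M : Z → ℝ} (hM : Integrable M μ) (hℓM : ∀ᵐ z ∂μ, ∀ β ∈ B, |ℓ z β| ≤ M z)
    (hmax : ∀ β ∈ B, β ≠ β₀ → ∫ z, ℓ z β ∂μ < ∫ z, ℓ z β₀ ∂μ)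
    (hsmooth : ∀ᵐ z ∂μ, ContDiffOn ℝ 3 (ℓ z) B₀)
    {K : Z → ℝ} (hK : Integrable K μ)
    (hℓK : ∀ᵐ z ∂μ, ∀ β ∈ B₀, ‖iteratedFDeriv ℝ 3 (ℓ z) β‖ ≤ K z)
    {J : EuclideanSpace ℝ ι →L[ℝ] EuclideanSpace ℝ ι →L[ℝ] ℝ}
    {J' : (EuclideanSpace ℝ ι →L[ℝ] ℝ) →L[ℝ] EuclideanSpace ℝ ι} (hJ' : ∀ v, J' (J v) = v)
    (hHint : Integrable (fun z => fderiv ℝ (fderiv ℝ (ℓ z)) β₀) μ)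
    (hH : ∫ z, fderiv ℝ (fderiv ℝ (ℓ z)) β₀ ∂μ = -J)
    {V : Matrix ι ι ℝ} (hV : V.PosSemidef)
    (hscore : MemLp (fun z => J' (fderiv ℝ (ℓ z) β₀)) 2 μ)
    (hscore0 : ∫ z, J' (fderiv ℝ (ℓ z) β₀) ∂μ = 0)
    (hcov : ∀ t : EuclideanSpace ℝ ι, ∫ z, inner ℝ t (J' (fderiv ℝ (ℓ z) β₀)) ^ 2 ∂μ
      = WithLp.ofLp t ⬝ᵥ V *ᵥ WithLp.ofLp t)
    (hQ : ∀ n, Differentiable ℝ (Q n)) (hc : Tendsto c atTop (𝓝 0))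
    (hQc : ∀ n, ∀ β ∈ B, |Q n β| ≤ c n ∧ ‖fderiv ℝ (Q n) β‖ ≤ c n)
    {b : ℕ → Ω → EuclideanSpace ℝ ι} (hbm : ∀ n, AEMeasurable (b n) P)
    (hbB : ∀ n, ∀ᵐ ω ∂P, b n ω ∈ B)
    (hb : ∀ n, ∀ᵐ ω ∂P, ∀ β ∈ B, ∑ i ∈ Finset.range n, ℓ (X i ω) β - Q n β
      ≤ ∑ i ∈ Finset.range n, ℓ (X i ω) (b n ω) - Q n (b n ω)) :
    IsBigOInProb P (fun n ω => ‖b n ω - β₀‖) (fun n => (n : ℝ) ^ (-(1 / 2) : ℝ)) ∧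
    TendstoInDistribution (fun (n : ℕ) ω => Real.sqrt (n : ℝ) • (b n ω - β₀)) atTop id (fun _ => P)
      (multivariateGaussian (0 : EuclideanSpace ℝ ι) V) := by
  have hcons := ae_tendsto_penalized_maximizer hX hindep hB (hsub hβ₀) hm hcont hM hℓM hmax hc
    (fun n β hβ => (hQc n β hβ).1) hbB (fun n => (hb n).mono fun ω h => h β₀ (hsub hβ₀))
  obtain ⟨ρ, hρ, hball⟩ := Metric.isOpen_iff.1 hB₀ β₀ hβ₀
  have hclt := tendstoInDistribution_clt hX hindep hscore hscore0 hV hcov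
  have htight := fun ε (hε : 0 < ε) => exists_norm_bound_of_tendstoInDistribution hclt (ε := ε) hε
  have hTm : ∀ n : ℕ, AEMeasurable (fun ω => Real.sqrt (n : ℝ) • (b n ω - β₀)) P := fun n => by
    have := hbm n
    fun_prop
  have hrel : ∀ᵐ ω ∂P, Tendsto (fun n : ℕ => (1 + ‖(Real.sqrt n)⁻¹ • ∑ i ∈ Finset.range n,
      J' (fderiv ℝ (ℓ (X i ω)) β₀)‖)⁻¹ * ‖Real.sqrt n • (b n ω - β₀)
        - (Real.sqrt n)⁻¹ • ∑ i ∈ Finset.range n, J' (fderiv ℝ (ℓ (X i ω)) β₀)‖) atTop (𝓝 0) := by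
    have hHl := ae_tendsto_average hX hindep hHint
    rw [hH] at hHl
    filter_upwards [hcons, hHl, ae_tendsto_average hX hindep hK, ae_forall_obs hX hsmooth,
      ae_forall_obs hX hℓK, ae_all_iff.2 hbB, ae_all_iff.2 hb] with ω h1 h2 h3 h4 h5 h6 h7
    exact tendsto_relative_error (ℓ := fun i => ℓ (X i ω)) (K := fun i => K (X i ω)) hρ hJ'
      (fun i => (h4 i).mono hball) (fun i β hβ => h5 i β (hball hβ)) h3 h2 hQ hc
      (fun n => (hQc n _ (h6 n)).2) (fun n β hβ => h7 n β (hsub (hball hβ))) h1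
  have hmeas := tendstoInMeasure_sub_of_ae hTm hclt.forall_aemeasurable htight hrel
  have hdist := tendstoInDistribution_of_tendstoInMeasure_sub _ _ hclt hmeas hTm
  refine ⟨fun ε hε => ?_, hdist⟩
  -- Tightness of the rescaled error, read without the factor `√n`, is the rate.
  obtain ⟨C, -, hC⟩ := exists_norm_bound_of_tendstoInDistribution hdist
    (ENNReal.ofReal_pos.2 hε)
  refine ⟨C, (eventually_ge_atTop 1).mono fun n hn => (measure_mono fun ω hω => ?_).trans (hC n)⟩
  have hn0 : (0 : ℝ) < n := by exact_mod_cast hn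
  have hs0 : 0 < Real.sqrt n := Real.sqrt_pos.2 hn0
  have hω' : C * (n : ℝ) ^ (-(1 / 2) : ℝ) < |‖b n ω - β₀‖| := hω
  rw [abs_norm, Real.rpow_neg hn0.le, ← Real.sqrt_eq_rpow, ← div_eq_mul_inv, div_lt_iff₀ hs0] at hω'
  change C < ‖Real.sqrt (n : ℝ) • (b n ω - β₀)‖
  rwa [norm_smul, Real.norm_of_nonneg hs0.le, mul_comm]

end Normality

/-! ### `L¹`-polar coordinates -/

theorem measurable_snoc {M : ℕ} {α : Type*} [MeasurableSpace α] {f : α → Fin M → ℝ} {g : α → ℝ}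
    (hf : Measurable f) (hg : Measurable g) :
    Measurable fun a => (Fin.snoc (α := fun _ => ℝ) (f a) (g a) : Fin (M + 1) → ℝ) := by
  refine measurable_pi_iff.2 fun j => ?_
  induction j using Fin.lastCases with
  | last => simpa using hg
  | cast i => simpa [Function.comp_def] using (measurable_pi_apply i).comp hf

theorem measurable_simplexPoint {M : ℕ} :
    Measurable (simplexPoint : (Fin M → ℝ) → Fin (M + 1) → ℝ) :=
  measurable_snoc measurable_id (by fun_prop)

theorem sum_simplexPoint {M : ℕ} (v : Fin M → ℝ) : ∑ j, simplexPoint v j = 1 := by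
  simp [simplexPoint, Fin.sum_univ_castSucc]

theorem simplexPoint_pos {M : ℕ} {v : Fin M → ℝ} (hv : v ∈ simplexChart M) (j : Fin (M + 1)) :
    0 < simplexPoint v j := by
  induction j using Fin.lastCases with
  | last => simpa [simplexPoint] using hv.2
  | cast i => simpa [simplexPoint] using hv.1 i

theorem measurableSet_simplexChart (M : ℕ) : MeasurableSet (simplexChart M) := by
  have : simplexChart M = (⋂ i, {v : Fin M → ℝ | 0 < v i}) ∩ {v | ∑ i, v i < 1} := by
    ext v; simp [simplexChart]
  rw [this]
  exact (MeasurableSet.iInter fun i =>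
    measurableSet_lt measurable_const (measurable_pi_apply i)).inter
      (measurableSet_lt (by fun_prop) measurable_const)

theorem measurableSet_posOrthant (d : ℕ) : MeasurableSet (posOrthant d) := by
  have : posOrthant d = ⋂ j, {y : Fin d → ℝ | 0 < y j} := by ext y; simp [posOrthant]
  rw [this]
  exact MeasurableSet.iInter fun i => measurableSet_lt measurable_const (measurable_pi_apply i)

theorem measurableSet_extremeSet {d : ℕ} (r : Fin d → ℝ) : MeasurableSet (extremeSet r) := by
  have : extremeSet r = posOrthant d ∩ {y | 1 < ∑ j, y j / r j} := by
    ext y; simp [posOrthant, extremeSet]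
  rw [this]
  exact (measurableSet_posOrthant d).inter (measurableSet_lt measurable_const (by fun_prop))

theorem lintegral_pi_smul {M : ℕ} {s : ℝ} (hs : 0 < s) {H : (Fin M → ℝ) → ℝ≥0∞}
    (hH : Measurable H) :
    ∫⁻ u, H u = ENNReal.ofReal (s ^ M) * ∫⁻ v, H (s • v) := by
  have h1 : ∫⁻ v, H (s • v) = ∫⁻ u, H u ∂(Measure.map (fun x => s • x) volume) :=
    (lintegral_map hH (measurable_const_smul s)).symm
  rw [h1, Measure.map_addHaar_smul _ hs.ne', lintegral_smul_measure, smul_eq_mul, ← mul_assoc,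
    ← ENNReal.ofReal_mul (by positivity), Module.finrank_fin_fun, abs_of_pos (by positivity),
    mul_inv_cancel₀ (by positivity), ENNReal.ofReal_one, one_mul]

theorem smul_simplexPoint_eq_snoc {M : ℕ} (s : ℝ) (v : Fin M → ℝ) :
    s • simplexPoint v = Fin.snoc (α := fun _ => ℝ) (s • v) (s - ∑ i, (s • v) i) := by
  funext j
  induction j using Fin.lastCases with
  | last => simp [simplexPoint, mul_sub, Finset.mul_sum]
  | cast i => simp [simplexPoint]

/-- Replacing the last coordinate by the total `s` is, for fixed other coordinates, a translation;
rescaling the remaining `M` coordinates by `s` produces the Jacobian `s ^ M`. -/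
theorem lintegral_posOrthant {M : ℕ} {F : (Fin (M + 1) → ℝ) → ℝ≥0∞} (hF : Measurable F) :
    ∫⁻ y in posOrthant (M + 1), F y = ∫⁻ s in Set.Ioi (0 : ℝ), ∫⁻ v in simplexChart M,
      ENNReal.ofReal (s ^ M) * F (s • simplexPoint v) := by
  set G := (posOrthant (M + 1)).indicator F with hGdef
  have hG : Measurable G := hF.indicator (measurableSet_posOrthant _)
  have hGs : Measurable fun p : (Fin M → ℝ) × ℝ =>
      G (Fin.snoc (α := fun _ => ℝ) p.1 (p.2 - ∑ i, p.1 i)) :=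
    hG.comp (measurable_snoc measurable_fst (by fun_prop))
  have h1 : ∫⁻ y, G y = ∫⁻ u : Fin M → ℝ, ∫⁻ t : ℝ, G (Fin.snoc (α := fun _ => ℝ) u t) := by
    have h := (volume_preserving_piFinSuccAbove (fun _ : Fin (M + 1) => ℝ)
      (Fin.last M)).symm.lintegral_comp hG
    rw [← h, Measure.volume_eq_prod, lintegral_prod_symm]
    · refine lintegral_congr fun u => lintegral_congr fun t => ?_
      congr 1
      exact Fin.insertNth_last' (β := ℝ) t u
    · exact (hG.comp (MeasurableEquiv.measurable _)).aemeasurable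
  have h2 : ∫⁻ u : Fin M → ℝ, ∫⁻ t : ℝ, G (Fin.snoc (α := fun _ => ℝ) u t)
      = ∫⁻ s : ℝ, ∫⁻ u : Fin M → ℝ, G (Fin.snoc (α := fun _ => ℝ) u (s - ∑ i, u i)) := by
    rw [← lintegral_lintegral_swap
      (f := fun (u : Fin M → ℝ) s => G (Fin.snoc (α := fun _ => ℝ) u (s - ∑ i, u i)))
      hGs.aemeasurable]
    refine lintegral_congr fun u => ?_
    exact (lintegral_sub_right_eq_self (fun t => G (Fin.snoc (α := fun _ => ℝ) u t)) _).symm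
  rw [← lintegral_indicator (measurableSet_posOrthant _), h1, h2,
    ← lintegral_indicator measurableSet_Ioi]
  refine lintegral_congr fun s => ?_
  by_cases hs : 0 < s
  · have hGu : Measurable fun u : Fin M → ℝ =>
        G (Fin.snoc (α := fun _ => ℝ) u (s - ∑ i, u i)) :=
      hG.comp (measurable_snoc measurable_id (by fun_prop))
    rw [Set.indicator_of_mem (show s ∈ Set.Ioi 0 from hs), lintegral_pi_smul hs hGu,
      lintegral_const_mul', ← lintegral_indicator (measurableSet_simplexChart M)]
    · congr 1
      refine lintegral_congr fun v => ?_
      rw [← smul_simplexPoint_eq_snoc]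
      by_cases hv : v ∈ simplexChart M
      · rw [Set.indicator_of_mem hv, hGdef, Set.indicator_of_mem]
        exact fun j => mul_pos hs (simplexPoint_pos hv j)
      -- For `s > 0` the point `s • simplexPoint v` lies in the orthant only if `v` lies in the
      -- simplex.
      · rw [Set.indicator_of_notMem hv, hGdef, Set.indicator_of_notMem]
        intro hmem
        have hp : ∀ j, 0 < simplexPoint v j := fun j => (mul_pos_iff_of_pos_left hs).1 (hmem j)
        exact hv ⟨fun i => by simpa [simplexPoint] using hp i.castSucc,
          by simpa [simplexPoint] using hp (Fin.last M)⟩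
    · exact ENNReal.ofReal_ne_top
  · rw [Set.indicator_of_notMem (show s ∉ Set.Ioi 0 from hs)]
    refine (lintegral_congr fun u => ?_).trans lintegral_zero
    rw [hGdef, Set.indicator_of_notMem]
    intro hmem
    have : 0 < ∑ j, (Fin.snoc (α := fun _ => ℝ) u (s - ∑ i, u i) : Fin (M + 1) → ℝ) j :=
      Finset.sum_pos (fun j _ => hmem j) Finset.univ_nonempty
    rw [Fin.sum_univ_castSucc] at this
    simp at this
    exact hs this

theorem lintegral_Ioi_inv_sq {c : ℝ} (hc : 0 < c) :
    ∫⁻ s in Set.Ioi c, ENNReal.ofReal ((s ^ 2)⁻¹) = ENNReal.ofReal c⁻¹ := by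
  have h1 : ∫⁻ s in Set.Ioi c, ENNReal.ofReal ((s ^ 2)⁻¹)
      = ∫⁻ s in Set.Ioi c, ENNReal.ofReal (s ^ (-2 : ℝ)) := by
    refine setLIntegral_congr_fun measurableSet_Ioi fun s hs => ?_
    have hs0 : 0 < s := hc.trans hs
    rw [Real.rpow_neg hs0.le, Real.rpow_two]
  rw [h1, ← ofReal_integral_eq_lintegral_ofReal (integrableOn_Ioi_rpow_of_lt (by norm_num) hc),
    integral_Ioi_rpow_of_lt (by norm_num) hc]
  · congr 1
    rw [show (-2 : ℝ) + 1 = -1 by norm_num, Real.rpow_neg_one]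
    simp
  · filter_upwards [ae_restrict_mem measurableSet_Ioi] with s hs
    exact Real.rpow_nonneg (hc.trans hs).le _

theorem l1_smul_simplexPoint {M : ℕ} {s : ℝ} (hs : 0 < s) {v : Fin M → ℝ}
    (hv : v ∈ simplexChart M) : l1 (s • simplexPoint v) = s := by
  have : ∀ j, |(s • simplexPoint v) j| = s * simplexPoint v j := fun j =>
    abs_of_pos (mul_pos hs (simplexPoint_pos hv j))
  simp only [l1, this, ← Finset.mul_sum, sum_simplexPoint, mul_one]

theorem angle_smul_simplexPoint {M : ℕ} {s : ℝ} (hs : 0 < s) {v : Fin M → ℝ}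
    (hv : v ∈ simplexChart M) : angle (s • simplexPoint v) = simplexPoint v := by
  funext j
  simp only [angle, l1_smul_simplexPoint hs hv, Pi.smul_apply, smul_eq_mul]
  exact mul_div_cancel_left₀ _ hs.ne'

@[fun_prop]
theorem measurable_l1 {d : ℕ} : Measurable (l1 : (Fin d → ℝ) → ℝ) := by
  unfold l1
  exact Finset.measurable_fun_sum _ fun j _ => measurable_abs.comp (measurable_pi_apply j)

@[fun_prop]
theorem measurable_angle {d : ℕ} : Measurable (angle : (Fin d → ℝ) → Fin d → ℝ) :=
  measurable_pi_iff.2 fun j => (measurable_pi_apply j).div measurable_l1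

/-- The total mass in the extreme region of the intensity `‖y‖ ^ (-(d + 1)) g(y / ‖y‖)`. -/
theorem lintegral_extremeSet_intensity {M : ℕ} {r : Fin (M + 1) → ℝ} (hr : ∀ j, 0 < r j)
    {g : (Fin (M + 1) → ℝ) → ℝ} (hg : Measurable g)
    (hmom : ∀ j, ∫⁻ v in simplexChart M,
      ENNReal.ofReal (simplexPoint v j * g (simplexPoint v)) = 1) :
    ∫⁻ y in extremeSet r, ENNReal.ofReal ((l1 y ^ (M + 2))⁻¹ * g (angle y))
      = ENNReal.ofReal (∑ j, (r j)⁻¹) := by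
  set A : (Fin M → ℝ) → ℝ := fun v => ∑ j, simplexPoint v j / r j with hA
  set F : (Fin (M + 1) → ℝ) → ℝ≥0∞ := {y | 1 < ∑ j, y j / r j}.indicator
    fun y => ENNReal.ofReal ((l1 y ^ (M + 2))⁻¹ * g (angle y)) with hF
  have hS : MeasurableSet {y : Fin (M + 1) → ℝ | 1 < ∑ j, y j / r j} :=
    measurableSet_lt measurable_const (by fun_prop)
  have hFm : Measurable F := Measurable.indicator (by fun_prop) hS
  have hE : extremeSet r = {y | 1 < ∑ j, y j / r j} ∩ posOrthant (M + 1) := by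
    ext y; simp [posOrthant, extremeSet, and_comm]
  have hsm : Measurable fun p : ℝ × (Fin M → ℝ) => p.1 • simplexPoint p.2 :=
    measurable_fst.smul (measurable_simplexPoint.comp measurable_snd)
  have hA0 : ∀ v ∈ simplexChart M, 0 < A v := fun v hv =>
    Finset.sum_pos (fun j _ => div_pos (simplexPoint_pos hv j) (hr j)) Finset.univ_nonempty
  have hmeasj : ∀ j, Measurable fun v : Fin M → ℝ =>
      ENNReal.ofReal (simplexPoint v j * g (simplexPoint v)) := fun j =>
    (((measurable_pi_apply j).comp measurable_simplexPoint).mul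
      (hg.comp measurable_simplexPoint)).ennreal_ofReal
  -- On the ray through `v` the extreme region is `s > 1 / A v`, and the powers of `s` combine to
  -- `s⁻²`, with integral `A v`. As `A v` is linear in the simplex point, the moment constraints
  -- then suffice to integrate over `v`.
  have hradial : ∀ v ∈ simplexChart M, ∫⁻ s in Set.Ioi (0 : ℝ),
      ENNReal.ofReal (s ^ M) * F (s • simplexPoint v)
      = ∑ j, ENNReal.ofReal (r j)⁻¹ * ENNReal.ofReal (simplexPoint v j * g (simplexPoint v)) := by
    intro v hv
    have h1 : ∫⁻ s in Set.Ioi (0 : ℝ), ENNReal.ofReal (s ^ M) * F (s • simplexPoint v)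
        = ∫⁻ s in Set.Ioi (0 : ℝ), (Set.Ioi (A v)⁻¹).indicator
          (fun s => ENNReal.ofReal (g (simplexPoint v)) * ENNReal.ofReal ((s ^ 2)⁻¹)) s := by
      refine setLIntegral_congr_fun measurableSet_Ioi fun s hs => ?_
      have hs0 : 0 < s := hs
      have hsum : ∑ j, (s • simplexPoint v) j / r j = s * A v := by
        simp only [hA, Finset.mul_sum, Pi.smul_apply, smul_eq_mul, mul_div_assoc]
      have hiff : s • simplexPoint v ∈ {y : Fin (M + 1) → ℝ | 1 < ∑ j, y j / r j}
          ↔ s ∈ Set.Ioi (A v)⁻¹ := by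
        simp only [Set.mem_ofPred_eq, hsum, Set.mem_Ioi]
        rw [inv_lt_iff_one_lt_mul₀ (hA0 v hv)]
      simp only [hF]
      by_cases hmem : s ∈ Set.Ioi (A v)⁻¹
      · rw [Set.indicator_of_mem (hiff.2 hmem), Set.indicator_of_mem hmem,
          l1_smul_simplexPoint hs0 hv, angle_smul_simplexPoint hs0 hv, ← ENNReal.ofReal_mul
          (by positivity), mul_comm (ENNReal.ofReal (g _)), ← ENNReal.ofReal_mul (by positivity)]
        congr 1
        rw [pow_add]
        field_simp
      · rw [Set.indicator_of_notMem (fun h => hmem (hiff.1 h)), Set.indicator_of_notMem hmem,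
          mul_zero]
    rw [h1, lintegral_indicator measurableSet_Ioi, Measure.restrict_restrict measurableSet_Ioi,
      Set.inter_eq_left.2 (Set.Ioi_subset_Ioi (inv_pos.2 (hA0 v hv)).le),
      lintegral_const_mul' _ _ ENNReal.ofReal_ne_top,
      lintegral_Ioi_inv_sq (inv_pos.2 (hA0 v hv)), inv_inv, mul_comm,
      hA, ENNReal.ofReal_sum_of_nonneg
        (fun j _ => div_nonneg (simplexPoint_pos hv j).le (hr j).le), Finset.sum_mul]
    refine Finset.sum_congr rfl fun j _ => ?_
    have hj := (simplexPoint_pos hv j).le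
    have hrj := (hr j).le
    rw [← ENNReal.ofReal_mul (div_nonneg hj hrj), ← ENNReal.ofReal_mul (inv_nonneg.2 hrj)]
    congr 1
    ring
  have h0 : ∫⁻ y in extremeSet r, ENNReal.ofReal ((l1 y ^ (M + 2))⁻¹ * g (angle y))
      = ∫⁻ y in posOrthant (M + 1), F y := by
    rw [hF, lintegral_indicator hS, Measure.restrict_restrict hS, hE]
  rw [h0, lintegral_posOrthant hFm, lintegral_lintegral_swap
    (((measurable_fst.pow_const M).ennreal_ofReal.mul (hFm.comp hsm)).aemeasurable),
    setLIntegral_congr_fun (measurableSet_simplexChart M) hradial,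
    lintegral_finsetSum _ fun j _ => (hmeasj j).const_mul _,
    ENNReal.ofReal_sum_of_nonneg fun j _ => inv_nonneg.2 (hr j).le]
  refine Finset.sum_congr rfl fun j _ => ?_
  rw [lintegral_const_mul _ (hmeasj j), hmom, mul_one]

/-! ### The model: measurability and normalization -/

theorem measurable_bspline (t : ℕ → ℝ) (b : ℝ) (r : ℕ) : ∀ s, Measurable (bspline t b r s) := by
  classical
  induction r with
  | zero =>
    intro s
    have : bspline t b 0 s = fun x =>
        if (x < b ∧ t s ≤ x ∧ x < t (s + 1)) ∨ (b ≤ x ∧ t s < x ∧ x ≤ t (s + 1)) then (1 : ℝ)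
        else 0 := by
      funext x; simp only [bspline]
    rw [this]
    refine Measurable.ite ?_ measurable_const measurable_const
    exact (measurableSet_Iio.inter (measurableSet_Ici.inter measurableSet_Iio)).union
      (measurableSet_Ici.inter (measurableSet_Ioi.inter measurableSet_Iic))
  | succ r ih =>
    intro s
    have h1 := ih s
    have h2 := ih (s + 1)
    have : bspline t b (r + 1) s = fun x => (x - t s) / (t (s + r + 1) - t s) * bspline t b r s x
        + (t (s + r + 2) - x) / (t (s + r + 2) - t (s + 1)) * bspline t b r (s + 1) x := by
      funext x; simp only [bspline]
    rw [this]
    fun_prop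

namespace Model

variable {M p q D : ℕ} (𝓜 : Model M p q D)

theorem measurable_design (l : Fin p) (a : CoefIdx p q D) :
    Measurable fun x => 𝓜.design x l a := by
  rcases a with l' | ⟨k, l', s⟩
  · simp only [design, Matrix.of_apply]
    exact measurable_const
  · simp only [design, Matrix.of_apply]
    split_ifs
    · unfold basisFun
      exact Finset.measurable_fun_sum _ fun t _ =>
        ((measurable_bspline _ _ _ _).comp (measurable_pi_apply k)).const_mul _
    · exact measurable_const

theorem measurable_predictor (β : Coef p q D) : Measurable fun x => 𝓜.predictor x β :=
  measurable_pi_iff.2 fun l => Finset.measurable_fun_sum _ fun a _ =>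
    (𝓜.measurable_design l a).mul_const _

theorem measurable_h_obs (β : Coef p q D) : Measurable fun z : Obs M q =>
    𝓜.h (angle z.2) fun l => (𝓜.link l).symm (𝓜.predictor z.1 β l) :=
  𝓜.measurable_h.comp ((measurable_angle.comp measurable_snd).prodMk
    (measurable_pi_iff.2 fun l => (𝓜.measurable_link_symm l).comp
      ((measurable_pi_apply l).comp ((𝓜.measurable_predictor β).comp measurable_fst))))

theorem measurable_logLik (β : Coef p q D) : Measurable fun z => 𝓜.logLik z β :=
  ((Real.measurable_log.comp (measurable_l1.comp measurable_snd)).const_mul _).add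
    (Real.measurable_log.comp (𝓜.measurable_h_obs β))

theorem measurable_density (β : Coef p q D) : Measurable fun z => 𝓜.density z β :=
  ((((measurable_l1.comp measurable_snd).pow_const _).inv).mul (𝓜.measurable_h_obs β)).div_const _

theorem sum_inv_thr_pos : 0 < ∑ j, (𝓜.thr j)⁻¹ :=
  Finset.sum_pos (fun j _ => inv_pos.2 (𝓜.thr_pos j)) Finset.univ_nonempty

theorem mem_source {β : Coef p q D} (hβ : 𝓜.Admissible β) {x : Fin q → ℝ} (hx : x ∈ 𝓜.covSpace)
    (l : Fin p) : (𝓜.link l).symm (𝓜.predictor x β l) ∈ (𝓜.link l).source :=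
  (𝓜.link l).map_target (hβ x hx l)

/-- The logarithm is undone by `exp` because `h` is positive at the angle. Positivity is known at
points given by the simplex chart, so the angle is first written in that form. -/
theorem density_eq_exp {β : Coef p q D} (hβ : 𝓜.Admissible β) {z : Obs M q}
    (hx : z.1 ∈ 𝓜.covSpace) (hy : z.2 ∈ posOrthant (M + 1)) :
    𝓜.density z β = Real.exp (𝓜.logLik z β) / ∑ j, (𝓜.thr j)⁻¹ := by
  have hl : 0 < l1 z.2 :=
    Finset.sum_pos (fun j _ => abs_pos.2 (hy j).ne') Finset.univ_nonempty
  have hsum : ∑ j, angle z.2 j = 1 := by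
    simp only [angle, ← Finset.sum_div]
    rw [div_eq_one_iff_eq hl.ne', l1]
    exact Finset.sum_congr rfl fun j _ => (abs_of_pos (hy j)).symm
  have hang : ∀ j, 0 < angle z.2 j := fun j => div_pos (hy j) hl
  have hpt : angle z.2 = simplexPoint fun i => angle z.2 (Fin.castSucc i) := by
    rw [Fin.sum_univ_castSucc] at hsum
    funext j
    induction j using Fin.lastCases with
    | last => simp only [simplexPoint, Fin.snoc_last]; linarith
    | cast i => simp [simplexPoint]
  have hh : 0 < 𝓜.h (angle z.2) fun l => (𝓜.link l).symm (𝓜.predictor z.1 β l) := by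
    have := 𝓜.h_pos _ (𝓜.mem_source hβ hx) (fun i => angle z.2 (Fin.castSucc i))
      ⟨fun i => hang _, by
        rw [Fin.sum_univ_castSucc] at hsum
        linarith [hang (Fin.last M)]⟩
    rwa [← hpt] at this
  have hexp : Real.exp (-((M : ℝ) + 2) * Real.log (l1 z.2)) = (l1 z.2 ^ (M + 2))⁻¹ := by
    rw [neg_mul, Real.exp_neg, mul_comm, ← Real.rpow_def_of_pos hl]
    norm_cast
  rw [density, logLik, logLikEta, logLikTheta, Real.exp_add, hexp, Real.exp_log hh]

/-- That the mass does not depend on `β` underlies both the score identities and the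
likelihood-ratio inequality. -/
theorem lintegral_density {ν : Measure (Fin q → ℝ)} [IsProbabilityMeasure ν]
    (hν : ∀ᵐ x ∂ν, x ∈ 𝓜.covSpace) {β : Coef p q D} (hβ : 𝓜.Admissible β) :
    ∫⁻ z, ENNReal.ofReal (𝓜.density z β) ∂(𝓜.refMeasure ν) = 1 := by
  have hc := 𝓜.sum_inv_thr_pos
  rw [refMeasure, lintegral_prod _ (𝓜.measurable_density β).ennreal_ofReal.aemeasurable]
  have : ∀ᵐ x ∂ν, ∫⁻ y, ENNReal.ofReal (𝓜.density (x, y) β)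
      ∂(volume.restrict (extremeSet 𝓜.thr)) = 1 := by
    filter_upwards [hν] with x hx
    have hm := 𝓜.measurable_h.comp
      (measurable_id.prodMk (measurable_const (a := fun l => (𝓜.link l).symm (𝓜.predictor x β l))))
    have h := lintegral_extremeSet_intensity 𝓜.thr_pos hm (𝓜.moment _ (𝓜.mem_source hβ hx))
    simp only [density, div_eq_mul_inv _ (∑ j, (𝓜.thr j)⁻¹),
      ENNReal.ofReal_mul' (inv_nonneg.2 hc.le)]
    rw [lintegral_mul_const' _ _ ENNReal.ofReal_ne_top]
    refine (congrArg (· * _) h).trans ?_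
    rw [← ENNReal.ofReal_mul hc.le, mul_inv_cancel₀ hc.ne', ENNReal.ofReal_one]
  rw [lintegral_congr_ae this, lintegral_one, measure_univ]

end Model

/-! ### Calculus of densities and of linear predictors -/

section Calculus

variable {E : Type*} [NormedAddCommGroup E] [NormedSpace ℝ E]

theorem fderiv_exp_div {f ℓ : E → ℝ} {c : ℝ} {U : Set E} (hU : IsOpen U)
    (hf : ∀ β ∈ U, f β = Real.exp (ℓ β) / c) (hℓ : DifferentiableOn ℝ ℓ U) {β : E} (hβ : β ∈ U) :
    fderiv ℝ f β = f β • fderiv ℝ ℓ β := by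
  have hd := ((hℓ β hβ).differentiableAt (hU.mem_nhds hβ)).hasFDerivAt
  have h : HasFDerivAt (fun b => Real.exp (ℓ b) * c⁻¹) (c⁻¹ • (Real.exp (ℓ β) • fderiv ℝ ℓ β)) β :=
    hd.exp.mul_const c⁻¹
  have h' : f =ᶠ[𝓝 β] fun b => Real.exp (ℓ b) * c⁻¹ :=
    eventually_of_mem (hU.mem_nhds hβ) fun b hb => by rw [hf b hb, div_eq_mul_inv]
  rw [(h.congr_of_eventuallyEq h').fderiv, smul_smul, hf β hβ, div_eq_inv_mul]

/-- Product rule applied to `f' = f ℓ'`; integrated, it yields the information identity. -/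
theorem fderiv_fderiv_exp_div {f ℓ : E → ℝ} {c : ℝ} {U : Set E} (hU : IsOpen U)
    (hf : ∀ β ∈ U, f β = Real.exp (ℓ β) / c) (hℓ : ContDiffOn ℝ 2 ℓ U) {β : E} (hβ : β ∈ U)
    (u v : E) :
    fderiv ℝ (fderiv ℝ f) β u v
      = f β * fderiv ℝ (fderiv ℝ ℓ) β u v + f β * (fderiv ℝ ℓ β u * fderiv ℝ ℓ β v) := by
  have hℓ1 : DifferentiableOn ℝ ℓ U := hℓ.differentiableOn two_ne_zero
  have hd2 := (((hℓ.fderiv_of_isOpen hU (m := 1) (by norm_num)).differentiableOn one_ne_zero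
    β hβ).differentiableAt (hU.mem_nhds hβ)).hasFDerivAt
  have hfd : DifferentiableAt ℝ f β := by
    have h' : f =ᶠ[𝓝 β] fun b => Real.exp (ℓ b) / c := eventually_of_mem (hU.mem_nhds hβ) hf
    have hd : DifferentiableAt ℝ (fun b => Real.exp (ℓ b) / c) β := by
      simp only [div_eq_mul_inv]
      exact ((hℓ1 β hβ).differentiableAt (hU.mem_nhds hβ)).exp.mul_const c⁻¹
    exact hd.congr_of_eventuallyEq h'
  have h := hfd.hasFDerivAt.smul hd2
  have h' : fderiv ℝ f =ᶠ[𝓝 β] fun b => f b • fderiv ℝ ℓ b :=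
    eventually_of_mem (hU.mem_nhds hβ) fun b hb => fderiv_exp_div hU hf hℓ1 hb
  rw [(h.congr_of_eventuallyEq h').fderiv, fderiv_exp_div hU hf hℓ1 hβ]
  simp [mul_assoc]

theorem norm_iteratedFDeriv_two {f : E → ℝ} {β : E} :
    ‖iteratedFDeriv ℝ 2 f β‖ = ‖fderiv ℝ (fderiv ℝ f) β‖ := by
  rw [← norm_iteratedFDeriv_one, norm_iteratedFDeriv_fderiv]

/-- Chain rule for second derivatives along a linear map with a right inverse. -/
theorem fderiv_fderiv_comp_linear {G : Type*} [NormedAddCommGroup G] [NormedSpace ℝ G]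
    {g : G → ℝ} {L : E →L[ℝ] G} {R : G →L[ℝ] E} (hLR : ∀ η, L (R η) = η) {U : Set E}
    (hU : IsOpen U) (hg : ContDiffOn ℝ 2 (fun b => g (L b)) U) {β : E} (hβ : β ∈ U) (u v : E) :
    fderiv ℝ (fderiv ℝ fun b => g (L b)) β u v = fderiv ℝ (fderiv ℝ g) (L β) (L u) (L v) := by
  have hgL : ∀ b ∈ U, ContDiffAt ℝ 2 g (L b) := by
    intro b hb
    -- Smoothness is given for `g ∘ L` only. The affine section through `b` recovers `g` and takes
    -- `L b` back to `b`.
    have heq : g = (fun b => g (L b)) ∘ fun η => b + R (η - L b) := by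
      funext η
      simp [hLR]
    rw [heq]
    refine ContDiffAt.comp (L b) ?_ (by fun_prop)
    simpa using hg.contDiffAt (hU.mem_nhds hb)
  have hfirst : fderiv ℝ (fun b => g (L b)) =ᶠ[𝓝 β]
      fun b => (ContinuousLinearMap.compL ℝ E G ℝ).flip L (fderiv ℝ g (L b)) :=
    eventually_of_mem (hU.mem_nhds hβ) fun b hb =>
      (((hgL b hb).differentiableAt two_ne_zero).hasFDerivAt.comp b L.hasFDerivAt).fderiv
  have hd : HasFDerivAt (fderiv ℝ g) (fderiv ℝ (fderiv ℝ g) (L β)) (L β) :=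
    (((hgL β hβ).fderiv_right (m := 1) (by norm_num)).differentiableAt one_ne_zero).hasFDerivAt
  have h2 := ((ContinuousLinearMap.compL ℝ E G ℝ).flip L).hasFDerivAt.comp β
    (hd.comp β L.hasFDerivAt)
  rw [(h2.congr_of_eventuallyEq hfirst).fderiv]
  rfl

end Calculus

theorem integrable_clm {Z : Type*} [MeasurableSpace Z] {μ : Measure Z}
    {F : Type*} [NormedAddCommGroup F] [NormedSpace ℝ F] {ι : Type*} [Fintype ι] [DecidableEq ι]
    {L : Z → EuclideanSpace ℝ ι →L[ℝ] F}
    (hL : ∀ i, Integrable (fun z => L z (EuclideanSpace.single i 1)) μ) : Integrable L μ := by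
  have : L = fun z => ∑ i, ContinuousLinearMap.smulRightL ℝ (EuclideanSpace ℝ ι) F
      (EuclideanSpace.proj i) (L z (EuclideanSpace.single i 1)) := by
    funext z
    refine ContinuousLinearMap.ext fun v => ?_
    conv_lhs => rw [← (EuclideanSpace.basisFun ι ℝ).sum_repr v]
    simp
  rw [this]
  exact integrable_finsetSum _ fun i _ => ContinuousLinearMap.integrable_comp _ (hL i)

namespace Model

variable {M p q D : ℕ} (𝓜 : Model M p q D)

/-! ### The law of an observation -/

section Law

variable {ν : Measure (Fin q → ℝ)} {β : Coef p q D}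

theorem ae_refMeasure_mem (hν : ∀ᵐ x ∂ν, x ∈ 𝓜.covSpace) :
    ∀ᵐ z ∂(𝓜.refMeasure ν), z.1 ∈ 𝓜.covSpace ∧ z.2 ∈ posOrthant (M + 1) := by
  have h1 : ∀ᵐ z ∂(𝓜.refMeasure ν), z.1 ∈ 𝓜.covSpace :=
    Measure.quasiMeasurePreserving_fst.ae hν
  have h2 : ∀ᵐ y ∂(volume.restrict (extremeSet 𝓜.thr)), y ∈ posOrthant (M + 1) := by
    filter_upwards [ae_restrict_mem (measurableSet_extremeSet 𝓜.thr)] with y hy using hy.1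
  have h3 : ∀ᵐ z ∂(𝓜.refMeasure ν), z.2 ∈ posOrthant (M + 1) :=
    Measure.quasiMeasurePreserving_snd.ae h2
  exact h1.and h3

theorem ae_law_of_ae {p : Obs M q → Prop} (h : ∀ᵐ z ∂(𝓜.refMeasure ν), p z) :
    ∀ᵐ z ∂(𝓜.law ν β), p z :=
  (withDensity_absolutelyContinuous _ _).ae_le h

theorem density_pos (hβ : 𝓜.Admissible β) {z : Obs M q} (hx : z.1 ∈ 𝓜.covSpace)
    (hy : z.2 ∈ posOrthant (M + 1)) : 0 < 𝓜.density z β := by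
  rw [𝓜.density_eq_exp hβ hx hy]
  exact div_pos (Real.exp_pos _) 𝓜.sum_inv_thr_pos

/-- A positive density gives both measures the same null sets; identifiability is formulated for the
reference measure. -/
theorem ae_of_ae_law (hν : ∀ᵐ x ∂ν, x ∈ 𝓜.covSpace) (hβ : 𝓜.Admissible β) {p : Obs M q → Prop}
    (h : ∀ᵐ z ∂(𝓜.law ν β), p z) : ∀ᵐ z ∂(𝓜.refMeasure ν), p z := by
  rw [law, ae_withDensity_iff (𝓜.measurable_density β).ennreal_ofReal] at h
  filter_upwards [h, 𝓜.ae_refMeasure_mem hν] with z hz hz'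
  exact hz (ENNReal.ofReal_pos.2 (𝓜.density_pos hβ hz'.1 hz'.2)).ne'

theorem isProbabilityMeasure_law [IsProbabilityMeasure ν] (hν : ∀ᵐ x ∂ν, x ∈ 𝓜.covSpace)
    (hβ : 𝓜.Admissible β) :
    IsProbabilityMeasure (𝓜.law ν β) :=
  ⟨by rw [law, withDensity_apply _ MeasurableSet.univ, Measure.restrict_univ,
    𝓜.lintegral_density hν hβ]⟩

variable {F : Type*} [NormedAddCommGroup F] [NormedSpace ℝ F]

theorem integrable_law_iff (hν : ∀ᵐ x ∂ν, x ∈ 𝓜.covSpace) (hβ : 𝓜.Admissible β)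
    {g : Obs M q → F} :
    Integrable g (𝓜.law ν β) ↔ Integrable (fun z => 𝓜.density z β • g z) (𝓜.refMeasure ν) := by
  rw [law, integrable_withDensity_iff_integrable_smul' (𝓜.measurable_density β).ennreal_ofReal
    (Eventually.of_forall fun _ => ENNReal.ofReal_lt_top)]
  refine integrable_congr ?_
  filter_upwards [𝓜.ae_refMeasure_mem hν] with z hz
  rw [ENNReal.toReal_ofReal (𝓜.density_pos hβ hz.1 hz.2).le]

theorem integral_law (hν : ∀ᵐ x ∂ν, x ∈ 𝓜.covSpace) (hβ : 𝓜.Admissible β) (g : Obs M q → F) :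
    ∫ z, g z ∂(𝓜.law ν β) = ∫ z, 𝓜.density z β • g z ∂(𝓜.refMeasure ν) := by
  rw [law, integral_withDensity_eq_integral_toReal_smul (𝓜.measurable_density β).ennreal_ofReal
    (Eventually.of_forall fun _ => ENNReal.ofReal_lt_top)]
  refine integral_congr_ae ?_
  filter_upwards [𝓜.ae_refMeasure_mem hν] with z hz
  rw [ENNReal.toReal_ofReal (𝓜.density_pos hβ hz.1 hz.2).le]

theorem integrable_density [IsProbabilityMeasure ν] (hν : ∀ᵐ x ∂ν, x ∈ 𝓜.covSpace)
    (hβ : 𝓜.Admissible β) :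
    Integrable (fun z => 𝓜.density z β) (𝓜.refMeasure ν) := by
  have := 𝓜.isProbabilityMeasure_law hν hβ
  simpa using (𝓜.integrable_law_iff hν hβ (g := fun _ => (1 : ℝ))).1 (integrable_const 1)

theorem integral_density [IsProbabilityMeasure ν] (hν : ∀ᵐ x ∂ν, x ∈ 𝓜.covSpace)
    (hβ : 𝓜.Admissible β) :
    ∫ z, 𝓜.density z β ∂(𝓜.refMeasure ν) = 1 := by
  have := 𝓜.isProbabilityMeasure_law hν hβ
  have h := 𝓜.integral_law hν hβ (fun _ => (1 : ℝ))
  simpa using h.symm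

end Law

theorem score_apply (z : Obs M q) (β : Coef p q D) (a : CoefIdx p q D) :
    𝓜.score z β a = fderiv ℝ (𝓜.logLik z) β (EuclideanSpace.single a 1) := by
  rw [score, gradient, ← InnerProductSpace.toDual_symm_apply,
    EuclideanSpace.inner_single_right]
  simp

/-! ### The working weights -/

/-- The linear map `β ↦ X_VAM(x) β`. -/
noncomputable def predictorCLM (x : Fin q → ℝ) : Coef p q D →L[ℝ] (Fin p → ℝ) :=
  LinearMap.toContinuousLinearMap
    ((𝓜.design x).mulVecLin ∘ₗ (WithLp.linearEquiv 2 ℝ (CoefIdx p q D → ℝ)).toLinearMap)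

theorem predictorCLM_apply (x : Fin q → ℝ) (β : Coef p q D) :
    𝓜.predictorCLM x β = 𝓜.predictor x β := rfl

/-- The coefficient vectors with given intercepts and vanishing smooth terms. -/
noncomputable def interceptCLM (p q D : ℕ) : (Fin p → ℝ) →L[ℝ] Coef p q D :=
  ∑ l, (ContinuousLinearMap.proj l : (Fin p → ℝ) →L[ℝ] ℝ).smulRight
    (EuclideanSpace.single (Sum.inl l) (1 : ℝ) : Coef p q D)

theorem predictorCLM_single (x : Fin q → ℝ) (a : CoefIdx p q D) (l : Fin p) :
    𝓜.predictorCLM x (EuclideanSpace.single a 1) l = 𝓜.design x l a := by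
  rw [predictorCLM_apply, predictor, PiLp.ofLp_single, Matrix.mulVec_single_one]
  rfl

/-- Intercepts alone reach every predictor vector. This right inverse carries smoothness in `β` over
to smoothness in `η`. -/
theorem predictorCLM_interceptCLM (x : Fin q → ℝ) (η : Fin p → ℝ) :
    𝓜.predictorCLM x (interceptCLM p q D η) = η := by
  funext l
  simp [interceptCLM, predictorCLM_single, design, sum_apply]

/-- The columns of the design matrix are the images of the coordinate vectors, and linearity of the
predictor leaves no first-derivative term in the chain rule. -/
theorem design_weight_design (z : Obs M q) {U : Set (Coef p q D)} (hU : IsOpen U)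
    (hℓ : ContDiffOn ℝ 2 (𝓜.logLik z) U) {β : Coef p q D} (hβ : β ∈ U) (a b : CoefIdx p q D) :
    ((𝓜.design z.1)ᵀ * 𝓜.weight z β * 𝓜.design z.1) a b
      = -fderiv ℝ (fderiv ℝ (𝓜.logLik z)) β (EuclideanSpace.single a 1)
          (EuclideanSpace.single b 1) := by
  have h := fderiv_fderiv_comp_linear (g := 𝓜.logLikEta z.2)
    (𝓜.predictorCLM_interceptCLM z.1) hU hℓ hβ
    (EuclideanSpace.single a 1) (EuclideanSpace.single b 1)
  have hvec : ∀ a, 𝓜.predictorCLM z.1 (EuclideanSpace.single a 1)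
      = ∑ l, 𝓜.design z.1 l a • (Pi.single l 1 : Fin p → ℝ) := fun a => by
    funext l
    simp [predictorCLM_single, Pi.single_apply]
  refine Eq.trans ?_ (congrArg Neg.neg h.symm)
  rw [hvec a, hvec b]
  simp only [map_sum, map_smul, sum_apply, smul_apply,
    Matrix.mul_apply, Matrix.transpose_apply, weight, Matrix.of_apply, iteratedFDeriv_two_apply,
    predictorCLM_apply, Matrix.cons_val_zero, Matrix.cons_val_one, smul_eq_mul, Finset.mul_sum,
    Finset.sum_mul]
  rw [← Finset.sum_neg_distrib]
  refine Finset.sum_congr rfl fun l _ => ?_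
  rw [← Finset.sum_neg_distrib]
  refine Finset.sum_congr rfl fun l' _ => ?_
  ring

/-! ### The information identity -/

section Information

variable {𝓜} {ν : Measure (Fin q → ℝ)} {B B₀ : Set (Coef p q D)} {β₀ β : Coef p q D}

theorem Regular.ae_contDiffOn (hreg : 𝓜.Regular ν B B₀ β₀) (hν : ∀ᵐ x ∂ν, x ∈ 𝓜.covSpace) :
    ∀ᵐ z ∂(𝓜.refMeasure ν), ContDiffOn ℝ 3 (𝓜.logLik z) B₀ := by
  filter_upwards [𝓜.ae_refMeasure_mem hν] with z hz
  exact hreg.smooth z.1 hz.1 z.2 hz.2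

theorem Regular.admissible (hreg : 𝓜.Regular ν B B₀ β₀) (hBadm : ∀ β ∈ B, 𝓜.Admissible β)
    (hβ : β ∈ B₀) : 𝓜.Admissible β := hBadm β (hreg.subset hβ)

theorem Regular.ae_density_eq (hreg : 𝓜.Regular ν B B₀ β₀) (hν : ∀ᵐ x ∂ν, x ∈ 𝓜.covSpace)
    (hBadm : ∀ β ∈ B, 𝓜.Admissible β) : ∀ᵐ z ∂(𝓜.refMeasure ν), ∀ β ∈ B₀,
      𝓜.density z β = Real.exp (𝓜.logLik z β) / ∑ j, (𝓜.thr j)⁻¹ := by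
  filter_upwards [𝓜.ae_refMeasure_mem hν] with z hz β hβ
  exact 𝓜.density_eq_exp (hreg.admissible hBadm hβ) hz.1 hz.2

theorem Regular.ae_contDiffOn_density (hreg : 𝓜.Regular ν B B₀ β₀)
    (hν : ∀ᵐ x ∂ν, x ∈ 𝓜.covSpace) (hBadm : ∀ β ∈ B, 𝓜.Admissible β) :
    ∀ᵐ z ∂(𝓜.refMeasure ν), ContDiffOn ℝ 3 (𝓜.density z) B₀ := by
  filter_upwards [hreg.ae_contDiffOn hν, hreg.ae_density_eq hν hBadm] with z h1 h2
  exact (h1.exp.div_const _).congr h2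

variable [IsProbabilityMeasure ν]

theorem Regular.integral_fderiv_density (hreg : 𝓜.Regular ν B B₀ β₀)
    (hν : ∀ᵐ x ∂ν, x ∈ 𝓜.covSpace) (hBadm : ∀ β ∈ B, 𝓜.Admissible β) (hβ : β ∈ B₀) :
    Integrable (fun z => fderiv ℝ (𝓜.density z) β) (𝓜.refMeasure ν) ∧
      ∫ z, fderiv ℝ (𝓜.density z) β ∂(𝓜.refMeasure ν) = 0 :=
  integral_fderiv_eq_zero hreg.isOpen (fun β _ => (𝓜.measurable_density β).aestronglyMeasurable)
    ((hreg.ae_contDiffOn_density hν hBadm).mono fun _ h => h.of_le (by norm_num)) hreg.dom_deriv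
    (fun _ h => 𝓜.integrable_density hν (hreg.admissible hBadm h))
    (fun _ h => 𝓜.integral_density hν (hreg.admissible hBadm h)) hβ

/-- The gradient of the density again has an integral constant in `β`, namely zero, so the
first-order argument can be repeated. -/
theorem Regular.integral_fderiv_fderiv_density (hreg : 𝓜.Regular ν B B₀ β₀)
    (hν : ∀ᵐ x ∂ν, x ∈ 𝓜.covSpace) (hBadm : ∀ β ∈ B, 𝓜.Admissible β) (hβ : β ∈ B₀) :
    Integrable (fun z => fderiv ℝ (fderiv ℝ (𝓜.density z)) β) (𝓜.refMeasure ν) ∧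
      ∫ z, fderiv ℝ (fderiv ℝ (𝓜.density z)) β ∂(𝓜.refMeasure ν) = 0 := by
  have hfirst := fun β (hβ : β ∈ B₀) => hreg.integral_fderiv_density hν hBadm hβ
  refine integral_fderiv_eq_zero hreg.isOpen (fun β hβ => (hfirst β hβ).1.aestronglyMeasurable)
    ((hreg.ae_contDiffOn_density hν hBadm).mono fun _ h =>
      h.fderiv_of_isOpen hreg.isOpen (by norm_num)) ?_
    (fun β hβ => (hfirst β hβ).1) (fun β hβ => (hfirst β hβ).2) hβ
  have h := hreg.dom_deriv_two
  simpa only [← ofReal_norm, norm_iteratedFDeriv_two] using h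

theorem Regular.integral_score (hreg : 𝓜.Regular ν B B₀ β₀)
    (hν : ∀ᵐ x ∂ν, x ∈ 𝓜.covSpace) (hBadm : ∀ β ∈ B, 𝓜.Admissible β) (hβ : β ∈ B₀)
    (a : CoefIdx p q D) : ∫ z, 𝓜.score z β a ∂(𝓜.law ν β) = 0 := by
  obtain ⟨h1, h2⟩ := hreg.integral_fderiv_density hν hBadm hβ
  have h3 := ContinuousLinearMap.integral_apply h1 (EuclideanSpace.single a 1)
  rw [h2, zero_apply] at h3
  rw [𝓜.integral_law hν (hreg.admissible hBadm hβ), h3]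
  refine integral_congr_ae ?_
  filter_upwards [hreg.ae_contDiffOn hν, hreg.ae_density_eq hν hBadm] with z hz1 hz2
  rw [fderiv_exp_div hreg.isOpen hz2 (hz1.differentiableOn three_ne_zero) hβ, score_apply]
  rfl

theorem Regular.info_apply (hreg : 𝓜.Regular ν B B₀ β₀)
    (hν : ∀ᵐ x ∂ν, x ∈ 𝓜.covSpace) (hBadm : ∀ β ∈ B, 𝓜.Admissible β) (hβ : β ∈ B₀)
    (a b : CoefIdx p q D) :
    𝓜.info ν β a b = ∫ z, 𝓜.score z β a * 𝓜.score z β b ∂(𝓜.law ν β) := by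
  simp only [info, Matrix.of_apply, covariance, hreg.integral_score hν hBadm hβ, sub_zero]

/-- Since `f ∂²ℓ = ∂²f - f m mᵀ` and `∂²f` integrates to zero, both the integrability and the mean
of the Hessian follow from the square integrable score. -/
theorem Regular.integral_hessian (hreg : 𝓜.Regular ν B B₀ β₀)
    (hν : ∀ᵐ x ∂ν, x ∈ 𝓜.covSpace) (hBadm : ∀ β ∈ B, 𝓜.Admissible β) (hβ : β ∈ B₀) :
    Integrable (fun z => fderiv ℝ (fderiv ℝ (𝓜.logLik z)) β) (𝓜.law ν β) ∧
      ∀ a b : CoefIdx p q D, ∫ z, fderiv ℝ (fderiv ℝ (𝓜.logLik z)) β (EuclideanSpace.single a 1)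
        (EuclideanSpace.single b 1) ∂(𝓜.law ν β) = -𝓜.info ν β a b := by
  have hadm := hreg.admissible hBadm hβ
  obtain ⟨h1, h2⟩ := hreg.integral_fderiv_fderiv_density hν hBadm hβ
  have hss : ∀ a b : CoefIdx p q D,
      Integrable (fun z => 𝓜.density z β • (𝓜.score z β a * 𝓜.score z β b)) (𝓜.refMeasure ν) :=
    fun a b => (𝓜.integrable_law_iff hν hadm).1
      ((hreg.score_memLp β hβ a).integrable_mul (hreg.score_memLp β hβ b))
  have hf : ∀ a b : CoefIdx p q D, Integrable (fun z => fderiv ℝ (fderiv ℝ (𝓜.density z)) β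
      (EuclideanSpace.single a 1) (EuclideanSpace.single b 1)) (𝓜.refMeasure ν) := fun a b =>
    (h1.apply_continuousLinearMap _).apply_continuousLinearMap _
  have hf0 : ∀ a b : CoefIdx p q D, ∫ z, fderiv ℝ (fderiv ℝ (𝓜.density z)) β
      (EuclideanSpace.single a 1) (EuclideanSpace.single b 1) ∂(𝓜.refMeasure ν) = 0 := fun a b => by
    rw [← ContinuousLinearMap.integral_apply (h1.apply_continuousLinearMap _),
      ← ContinuousLinearMap.integral_apply h1, h2]
    rfl
  have heq : ∀ a b : CoefIdx p q D, (fun z => 𝓜.density z β •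
      fderiv ℝ (fderiv ℝ (𝓜.logLik z)) β (EuclideanSpace.single a 1) (EuclideanSpace.single b 1))
      =ᵐ[𝓜.refMeasure ν] fun z => fderiv ℝ (fderiv ℝ (𝓜.density z)) β
        (EuclideanSpace.single a 1) (EuclideanSpace.single b 1)
        - 𝓜.density z β • (𝓜.score z β a * 𝓜.score z β b) := fun a b => by
    filter_upwards [hreg.ae_contDiffOn hν, hreg.ae_density_eq hν hBadm] with z hz1 hz2
    rw [fderiv_fderiv_exp_div hreg.isOpen hz2 (hz1.of_le (by norm_num)) hβ, score_apply,
      score_apply, smul_eq_mul, smul_eq_mul]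
    ring
  refine ⟨integrable_clm fun a => integrable_clm fun b => (𝓜.integrable_law_iff hν hadm).2
    (((hf a b).sub (hss a b)).congr (heq a b).symm), fun a b => ?_⟩
  rw [𝓜.integral_law hν hadm, integral_congr_ae (heq a b), integral_sub (hf a b) (hss a b), hf0,
    zero_sub, hreg.info_apply hν hBadm hβ, 𝓜.integral_law hν hadm]

/-- `i(β) = E {X_VAMᵀ W(β) X_VAM}`. -/
theorem Regular.info_eq_integral_weight (hreg : 𝓜.Regular ν B B₀ β₀)
    (hν : ∀ᵐ x ∂ν, x ∈ 𝓜.covSpace) (hBadm : ∀ β ∈ B, 𝓜.Admissible β) (hβ : β ∈ B₀)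
    (a b : CoefIdx p q D) :
    Integrable (fun z => ((𝓜.design z.1)ᵀ * 𝓜.weight z β * 𝓜.design z.1) a b) (𝓜.law ν β) ∧
      𝓜.info ν β a b =
        ∫ z, ((𝓜.design z.1)ᵀ * 𝓜.weight z β * 𝓜.design z.1) a b ∂(𝓜.law ν β) := by
  obtain ⟨h1, h2⟩ := hreg.integral_hessian hν hBadm hβ
  have heq : (fun z => ((𝓜.design z.1)ᵀ * 𝓜.weight z β * 𝓜.design z.1) a b) =ᵐ[𝓜.law ν β]
      fun z => -fderiv ℝ (fderiv ℝ (𝓜.logLik z)) β (EuclideanSpace.single a 1)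
        (EuclideanSpace.single b 1) := by
    filter_upwards [𝓜.ae_law_of_ae (hreg.ae_contDiffOn hν)] with z hz
    exact 𝓜.design_weight_design z hreg.isOpen (hz.of_le (by norm_num)) hβ a b
  refine ⟨((h1.apply_continuousLinearMap _).apply_continuousLinearMap _).neg.congr heq.symm, ?_⟩
  rw [integral_congr_ae heq, integral_neg, h2, neg_neg]

end Information

end Model

namespace Model

variable {M p q D : ℕ} {𝓜 : Model M p q D}

/-! ### Dominating functions and the Kullback–Leibler inequality -/

section Regularity

variable {ν : Measure (Fin q → ℝ)} {B B₀ : Set (Coef p q D)} {β₀ β : Coef p q D}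

theorem Regular.exists_bound_logLik (hreg : 𝓜.Regular ν B B₀ β₀)
    (hν : ∀ᵐ x ∂ν, x ∈ 𝓜.covSpace)
    (hcont : ∀ x ∈ 𝓜.covSpace, ∀ y ∈ posOrthant (M + 1), ContinuousOn (𝓜.logLik (x, y)) B) :
    (∀ᵐ z ∂(𝓜.law ν β₀), ContinuousOn (𝓜.logLik z) B) ∧
    ∃ F : Obs M q → ℝ, Integrable F (𝓜.law ν β₀) ∧
      ∀ᵐ z ∂(𝓜.law ν β₀), ∀ β ∈ B, |𝓜.logLik z β| ≤ F z := by
  have hc : ∀ᵐ z ∂(𝓜.law ν β₀), ContinuousOn (𝓜.logLik z) B := by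
    filter_upwards [𝓜.ae_law_of_ae (𝓜.ae_refMeasure_mem hν)] with z hz
    exact hcont z.1 hz.1 z.2 hz.2
  obtain ⟨b, hb, hle⟩ := exists_integrable_bound (g := 𝓜.logLik) (S := B) hc
    (fun β _ => (𝓜.measurable_logLik β).aestronglyMeasurable) hreg.dom
  exact ⟨hc, b, hb, by simpa only [Real.norm_eq_abs] using hle⟩

theorem Regular.exists_bound_third (hreg : 𝓜.Regular ν B B₀ β₀) (hν : ∀ᵐ x ∂ν, x ∈ 𝓜.covSpace) :
    ∃ K : Obs M q → ℝ, Integrable K (𝓜.law ν β₀) ∧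
      ∀ᵐ z ∂(𝓜.law ν β₀), ∀ β ∈ B₀, ‖iteratedFDeriv ℝ 3 (𝓜.logLik z) β‖ ≤ K z := by
  choose F hF hFb using hreg.dom_third
  refine ⟨fun z => ∑ r : Fin 3 → CoefIdx p q D, F (r 0) (r 1) (r 2) z,
    integrable_finsetSum _ fun r _ => hF _ _ _, ?_⟩
  filter_upwards [𝓜.ae_law_of_ae (𝓜.ae_refMeasure_mem hν)] with z hz β hβ
  refine (norm_multilinear_le_sum _).trans (Finset.sum_le_sum fun r _ => ?_)
  have hr : (fun i => EuclideanSpace.single (r i) (1 : ℝ) : Fin 3 → Coef p q D)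
      = ![EuclideanSpace.single (r 0) 1, EuclideanSpace.single (r 1) 1,
        EuclideanSpace.single (r 2) 1] := by
    funext i; fin_cases i <;> rfl
  rw [hr, Real.norm_eq_abs]
  exact hFb _ _ _ z.1 hz.1 z.2 hz.2 β hβ

/-- The true parameter is the unique maximizer of the expected log-likelihood. -/
theorem Regular.integral_logLik_lt [IsProbabilityMeasure ν] (hreg : 𝓜.Regular ν B B₀ β₀)
    (hν : ∀ᵐ x ∂ν, x ∈ 𝓜.covSpace) (hBadm : ∀ β ∈ B, 𝓜.Admissible β)
    (hint : ∀ β ∈ B, Integrable (fun z => 𝓜.logLik z β) (𝓜.law ν β₀)) (hβ : β ∈ B)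
    (hne : β ≠ β₀) : ∫ z, 𝓜.logLik z β ∂(𝓜.law ν β₀) < ∫ z, 𝓜.logLik z β₀ ∂(𝓜.law ν β₀) := by
  have hβ₀ : β₀ ∈ B := hreg.subset hreg.mem
  have hadm := hBadm β₀ hβ₀
  have hprob := 𝓜.isProbabilityMeasure_law hν hadm
  -- The log-likelihood ratio satisfies `E exp u = 1`, so the nonnegative function `exp u - 1 - u`
  -- has mean `-E u`. If `E u ≥ 0`, it vanishes almost everywhere, forcing `u = 0` and contradicting
  -- identifiability.
  set u : Obs M q → ℝ := fun z => 𝓜.logLik z β - 𝓜.logLik z β₀ with hu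
  have huint : Integrable u (𝓜.law ν β₀) := (hint β hβ).sub (hint β₀ hβ₀)
  have hratio : (fun z => 𝓜.density z β₀ • Real.exp (u z)) =ᵐ[𝓜.refMeasure ν]
      fun z => 𝓜.density z β := by
    filter_upwards [𝓜.ae_refMeasure_mem hν] with z hz
    rw [𝓜.density_eq_exp hadm hz.1 hz.2, 𝓜.density_eq_exp (hBadm β hβ) hz.1 hz.2, hu, smul_eq_mul,
      Real.exp_sub]
    field_simp
  have heint : Integrable (fun z => Real.exp (u z)) (𝓜.law ν β₀) :=
    (𝓜.integrable_law_iff hν hadm).2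
      ((𝓜.integrable_density hν (hBadm β hβ)).congr hratio.symm)
  have heone : ∫ z, Real.exp (u z) ∂(𝓜.law ν β₀) = 1 := by
    rw [𝓜.integral_law hν hadm, integral_congr_ae hratio, 𝓜.integral_density hν (hBadm β hβ)]
  have huint1 : Integrable (fun z => u z + 1) (𝓜.law ν β₀) := huint.add (integrable_const 1)
  have hwint : Integrable (fun z => Real.exp (u z) - (u z + 1)) (𝓜.law ν β₀) :=
    heint.sub huint1
  have hw0 : 0 ≤ fun z => Real.exp (u z) - (u z + 1) := fun z =>
    sub_nonneg.2 (Real.add_one_le_exp _)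
  have hw : ∫ z, (Real.exp (u z) - (u z + 1)) ∂(𝓜.law ν β₀) = -∫ z, u z ∂(𝓜.law ν β₀) := by
    rw [integral_sub heint huint1, heone,
      integral_add huint (integrable_const 1)]
    simp
  have hsplit : ∫ z, u z ∂(𝓜.law ν β₀)
      = ∫ z, 𝓜.logLik z β ∂(𝓜.law ν β₀) - ∫ z, 𝓜.logLik z β₀ ∂(𝓜.law ν β₀) :=
    integral_sub (hint β hβ) (hint β₀ hβ₀)
  by_contra hle
  have hzero : ∫ z, (Real.exp (u z) - (u z + 1)) ∂(𝓜.law ν β₀) = 0 :=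
    le_antisymm (by rw [hw, hsplit]; linarith) (integral_nonneg hw0)
  refine hreg.ident β hβ β₀ hβ₀ hne (𝓜.ae_of_ae_law hν hadm ?_)
  filter_upwards [(integral_eq_zero_iff_of_nonneg hw0 hwint).1 hzero] with z hz
  by_contra hzne
  have := Real.add_one_lt_exp (sub_ne_zero.2 hzne)
  have hz' : Real.exp (u z) - (u z + 1) = 0 := hz
  simp only [hu] at hz'
  linarith

end Regularity

/-! ### The penalty -/

/-- The penalty `βᵀ P(γ) β / 2`. -/
noncomputable def penaltyForm (𝓜 : Model M p q D) (γ : Fin p → Fin q → ℝ) (β : Coef p q D) : ℝ :=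
  1 / 2 * (WithLp.ofLp β ⬝ᵥ (𝓜.penalty γ *ᵥ WithLp.ofLp β))

theorem tendsto_penalty {γ : ℕ → Fin p → Fin q → ℝ}
    (hγ : ∀ l k, Tendsto (fun n => γ n l k) atTop (𝓝 0)) (a b : CoefIdx p q D) :
    Tendsto (fun n => 𝓜.penalty (γ n) a b) atTop (𝓝 0) := by
  rcases a with l | ⟨k, l, s⟩ <;> rcases b with l' | ⟨k', l', s'⟩ <;>
    simp only [penalty, Matrix.of_apply, tendsto_const_nhds]
  split_ifs
  · simpa using (hγ l k).mul_const (𝓜.pen k s s')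
  · exact tendsto_const_nhds

theorem penaltyForm_eq (γ : Fin p → Fin q → ℝ) :
    𝓜.penaltyForm γ = fun β => ∑ a, ∑ b, 𝓜.penalty γ a b * (1 / 2 * (β a * β b)) := by
  funext β
  simp only [penaltyForm, dotProduct, Matrix.mulVec, Finset.mul_sum]
  refine Finset.sum_congr rfl fun a _ => Finset.sum_congr rfl fun b _ => ?_
  ring

theorem contDiff_penaltyForm (γ : Fin p → Fin q → ℝ) : ContDiff ℝ 1 (𝓜.penaltyForm γ) := by
  rw [penaltyForm_eq]
  fun_prop

/-- The penalty combines fixed quadratic monomials, bounded with their derivatives on the compact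
`B`, with coefficients tending to zero. -/
theorem exists_penaltyForm_bound {γ : ℕ → Fin p → Fin q → ℝ}
    (hγ : ∀ l k, Tendsto (fun n => γ n l k) atTop (𝓝 0)) {B : Set (Coef p q D)}
    (hB : IsCompact B) :
    ∃ c : ℕ → ℝ, Tendsto c atTop (𝓝 0) ∧ ∀ n, ∀ β ∈ B,
      |𝓜.penaltyForm (γ n) β| ≤ c n ∧ ‖fderiv ℝ (𝓜.penaltyForm (γ n)) β‖ ≤ c n := by
  set m : CoefIdx p q D → CoefIdx p q D → Coef p q D → ℝ := fun a b β => 1 / 2 * (β a * β b) with hm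
  have hmd : ∀ a b, ContDiff ℝ 1 (m a b) := fun a b => by
    simp only [hm]
    fun_prop
  have hbd : ∀ a b, ∃ C, ∀ β ∈ B, ‖m a b β‖ ≤ C ∧ ‖fderiv ℝ (m a b) β‖ ≤ C := fun a b => by
    obtain ⟨C₁, h₁⟩ := hB.exists_bound_of_continuousOn (hmd a b).continuous.continuousOn
    obtain ⟨C₂, h₂⟩ := hB.exists_bound_of_continuousOn
      ((hmd a b).continuous_fderiv one_ne_zero).continuousOn
    exact ⟨max C₁ C₂, fun β hβ => ⟨(h₁ β hβ).trans (le_max_left _ _),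
      (h₂ β hβ).trans (le_max_right _ _)⟩⟩
  choose C hC using hbd
  refine ⟨fun n => ∑ a, ∑ b, |𝓜.penalty (γ n) a b| * C a b, ?_, fun n β hβ => ⟨?_, ?_⟩⟩
  · have h := tendsto_finsetSum Finset.univ fun a _ => tendsto_finsetSum Finset.univ fun b _ =>
      ((tendsto_penalty (𝓜 := 𝓜) hγ a b).abs.mul_const (C a b))
    simpa using h
  · rw [penaltyForm_eq, ← Real.norm_eq_abs]
    refine norm_sum_le_of_le _ fun a _ => norm_sum_le_of_le _ fun b _ => ?_
    rw [norm_mul, Real.norm_eq_abs]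
    exact mul_le_mul_of_nonneg_left (hC a b β hβ).1 (abs_nonneg _)
  · have hd : HasFDerivAt (𝓜.penaltyForm (γ n))
        (∑ a, ∑ b, 𝓜.penalty (γ n) a b • fderiv ℝ (m a b) β) β := by
      rw [penaltyForm_eq]
      exact HasFDerivAt.fun_sum fun a _ => HasFDerivAt.fun_sum fun b _ =>
        (((hmd a b).differentiable one_ne_zero β).hasFDerivAt).const_mul _
    rw [hd.fderiv]
    refine norm_sum_le_of_le _ fun a _ => norm_sum_le_of_le _ fun b _ => ?_
    rw [norm_smul, Real.norm_eq_abs]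
    exact mul_le_mul_of_nonneg_left (hC a b β hβ).2 (abs_nonneg _)

end Model

/-! ### Inverting the information matrix -/

section Matrix

variable {ι : Type*} [Fintype ι] [DecidableEq ι]

theorem bilin_eq_dotProduct {J : EuclideanSpace ℝ ι →L[ℝ] EuclideanSpace ℝ ι →L[ℝ] ℝ}
    {S : Matrix ι ι ℝ}
    (hJ : ∀ a b, J (EuclideanSpace.single a 1) (EuclideanSpace.single b 1) = S a b)
    (u v : EuclideanSpace ℝ ι) : J u v = WithLp.ofLp u ⬝ᵥ S *ᵥ WithLp.ofLp v := by
  conv_lhs => rw [← (EuclideanSpace.basisFun ι ℝ).sum_repr u,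
    ← (EuclideanSpace.basisFun ι ℝ).sum_repr v]
  simp only [EuclideanSpace.basisFun_repr, EuclideanSpace.basisFun_apply, map_sum, map_smul,
    sum_apply, smul_apply, hJ, smul_eq_mul, dotProduct, Matrix.mulVec,
    Finset.mul_sum]
  rw [Finset.sum_comm]
  refine Finset.sum_congr rfl fun a _ => Finset.sum_congr rfl fun b _ => ?_
  ring

/-- The linear map `L ↦ A ∇L` on linear forms. -/
noncomputable def dualMatrixCLM (A : Matrix ι ι ℝ) :
    (EuclideanSpace ℝ ι →L[ℝ] ℝ) →L[ℝ] EuclideanSpace ℝ ι :=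
  ∑ b, (ContinuousLinearMap.apply ℝ ℝ (EuclideanSpace.single b (1 : ℝ))).smulRight
    (WithLp.toLp 2 fun a => A a b : EuclideanSpace ℝ ι)

theorem dualMatrixCLM_apply (A : Matrix ι ι ℝ) (L : EuclideanSpace ℝ ι →L[ℝ] ℝ) :
    WithLp.ofLp (dualMatrixCLM A L) = A *ᵥ fun b => L (EuclideanSpace.single b 1) := by
  funext a
  simp [dualMatrixCLM, Matrix.mulVec, dotProduct, sum_apply, mul_comm]

/-- Supplies the left inverse of `J` with which the score equation is solved for the estimation
error. Symmetry of `S` matters, as `J v` has coordinates `vᵀ S`. -/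
theorem dualMatrixCLM_inv_bilin {J : EuclideanSpace ℝ ι →L[ℝ] EuclideanSpace ℝ ι →L[ℝ] ℝ}
    {S : Matrix ι ι ℝ}
    (hJ : ∀ a b, J (EuclideanSpace.single a 1) (EuclideanSpace.single b 1) = S a b)
    (hS : S.PosDef) (v : EuclideanSpace ℝ ι) : dualMatrixCLM S⁻¹ (J v) = v := by
  have hST : Sᵀ = S := by simpa using hS.isHermitian.eq
  apply (WithLp.ofLp_injective 2)
  rw [dualMatrixCLM_apply]
  have : (fun b => J v (EuclideanSpace.single b 1)) = S *ᵥ WithLp.ofLp v := by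
    funext b
    rw [bilin_eq_dotProduct hJ, PiLp.ofLp_single, Matrix.mulVec_single_one, ← hST,
      Matrix.mulVec_transpose, hST]
    rfl
  rw [this, Matrix.mulVec_mulVec,
    Matrix.nonsing_inv_mul _ ((Matrix.isUnit_iff_isUnit_det _).1 hS.isUnit), Matrix.one_mulVec]

end Matrix

/-! ### The standardized score -/

section StandardizedScore

variable {ι : Type*} [Fintype ι]

theorem integral_dotProduct_sq {Z : Type*} [MeasurableSpace Z] {μ : Measure Z} {s : Z → ι → ℝ}
    (hs : ∀ a, MemLp (fun z => s z a) 2 μ) {S : Matrix ι ι ℝ}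
    (hS : ∀ a b, S a b = ∫ z, s z a * s z b ∂μ) (w : ι → ℝ) :
    ∫ z, (w ⬝ᵥ s z) ^ 2 ∂μ = w ⬝ᵥ S *ᵥ w := by
  have hint : ∀ a b, Integrable (fun z => w a * (s z a * s z b * w b)) μ := fun a b =>
    (((hs a).integrable_mul (hs b)).mul_const _).const_mul _
  have heq : ∀ z, (w ⬝ᵥ s z) ^ 2 = ∑ a, ∑ b, w a * (s z a * s z b * w b) := fun z => by
    simp only [sq, dotProduct, Finset.sum_mul_sum]
    refine Finset.sum_congr rfl fun a _ => Finset.sum_congr rfl fun b _ => ?_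
    ring
  simp only [heq]
  rw [integral_finsetSum _ fun a _ => integrable_finsetSum _ fun b _ => hint a b]
  simp only [dotProduct, Matrix.mulVec, Finset.mul_sum]
  refine Finset.sum_congr rfl fun a _ => ?_
  rw [integral_finsetSum _ fun b _ => hint a b]
  refine Finset.sum_congr rfl fun b _ => ?_
  rw [integral_const_mul, integral_mul_const, hS]

/-- The sandwich `S⁻¹ S S⁻¹` collapses: the score has covariance `S`, so the standardized score has
covariance `S⁻¹`. -/
theorem dotProduct_vecMul_inv [DecidableEq ι] {S : Matrix ι ι ℝ} (hS : S.PosDef) (t : ι → ℝ) :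
    (t ᵥ* S⁻¹) ⬝ᵥ S *ᵥ (t ᵥ* S⁻¹) = t ⬝ᵥ S⁻¹ *ᵥ t := by
  have hST : S⁻¹ᵀ = S⁻¹ := by simpa using hS.inv.isHermitian.eq
  have h : S *ᵥ (t ᵥ* S⁻¹) = t := by
    rw [← Matrix.mulVec_transpose, hST, Matrix.mulVec_mulVec,
      Matrix.mul_nonsing_inv _ ((Matrix.isUnit_iff_isUnit_det _).1 hS.isUnit), Matrix.one_mulVec]
  rw [h, Matrix.dotProduct_mulVec]

end StandardizedScore

namespace Model

variable {M p q D : ℕ} {𝓜 : Model M p q D} {ν : Measure (Fin q → ℝ)}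
  {B B₀ : Set (Coef p q D)} {β₀ β : Coef p q D}

theorem dualMatrixCLM_fderiv_logLik (A : Matrix (CoefIdx p q D) (CoefIdx p q D) ℝ) (z : Obs M q)
    (β : Coef p q D) : dualMatrixCLM A (fderiv ℝ (𝓜.logLik z) β)
      = ∑ b, 𝓜.score z β b • (WithLp.toLp 2 fun a => A a b : Coef p q D) := by
  simp only [dualMatrixCLM, sum_apply, score_apply]
  rfl

theorem inner_dualMatrixCLM_fderiv_logLik (A : Matrix (CoefIdx p q D) (CoefIdx p q D) ℝ)
    (z : Obs M q) (β t : Coef p q D) :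
    inner ℝ t (dualMatrixCLM A (fderiv ℝ (𝓜.logLik z) β))
      = (WithLp.ofLp t ᵥ* A) ⬝ᵥ fun b => 𝓜.score z β b := by
  rw [← Matrix.dotProduct_mulVec, EuclideanSpace.inner_eq_star_dotProduct, dualMatrixCLM_apply,
    dotProduct_comm]
  simp only [score_apply]
  rfl

theorem Regular.memLp_standardized_score (hreg : 𝓜.Regular ν B B₀ β₀) (hβ : β ∈ B₀)
    (A : Matrix (CoefIdx p q D) (CoefIdx p q D) ℝ) :
    MemLp (fun z => dualMatrixCLM A (fderiv ℝ (𝓜.logLik z) β)) 2 (𝓜.law ν β) := by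
  simp only [dualMatrixCLM_fderiv_logLik]
  exact memLp_finsetSum _ fun b _ =>
    (ContinuousLinearMap.toSpanSingleton ℝ _).comp_memLp' (hreg.score_memLp β hβ b)

variable [IsProbabilityMeasure ν]

theorem Regular.integral_standardized_score (hreg : 𝓜.Regular ν B B₀ β₀)
    (hν : ∀ᵐ x ∂ν, x ∈ 𝓜.covSpace) (hBadm : ∀ β ∈ B, 𝓜.Admissible β) (hβ : β ∈ B₀)
    (A : Matrix (CoefIdx p q D) (CoefIdx p q D) ℝ) :
    ∫ z, dualMatrixCLM A (fderiv ℝ (𝓜.logLik z) β) ∂(𝓜.law ν β) = 0 := by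
  have := 𝓜.isProbabilityMeasure_law hν (hreg.admissible hBadm hβ)
  simp only [dualMatrixCLM_fderiv_logLik]
  rw [integral_finsetSum _ fun b _ =>
    ((hreg.score_memLp β hβ b).integrable one_le_two).smul_const _]
  refine Finset.sum_eq_zero fun b _ => ?_
  rw [integral_smul_const, hreg.integral_score hν hBadm hβ, zero_smul]

theorem Regular.integral_inner_standardized_score_sq (hreg : 𝓜.Regular ν B B₀ β₀)
    (hν : ∀ᵐ x ∂ν, x ∈ 𝓜.covSpace) (hBadm : ∀ β ∈ B, 𝓜.Admissible β) (hβ : β ∈ B₀)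
    (t : Coef p q D) :
    ∫ z, inner ℝ t (dualMatrixCLM (𝓜.info ν β)⁻¹ (fderiv ℝ (𝓜.logLik z) β)) ^ 2 ∂(𝓜.law ν β)
      = WithLp.ofLp t ⬝ᵥ (𝓜.info ν β)⁻¹ *ᵥ WithLp.ofLp t := by
  simp only [inner_dualMatrixCLM_fderiv_logLik]
  rw [integral_dotProduct_sq (hreg.score_memLp β hβ) (hreg.info_apply hν hBadm hβ),
    dotProduct_vecMul_inv (hreg.info_posDef β hβ)]

end Model

end AngularReg

open AngularReg in
theorem theorem1 {M p q D : ℕ} (𝓜 : Model M p q D)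
    -- the law of the covariates, carried by the covariate space
    (ν : Measure (Fin q → ℝ)) [IsProbabilityMeasure ν] (hν : ∀ᵐ x ∂ν, x ∈ 𝓜.covSpace)
    -- the parameter set, with the log-likelihood continuous on it
    (B B₀ : Set (Coef p q D)) (β₀ : Coef p q D)
    (hBcompact : IsCompact B) (hBadm : ∀ β ∈ B, 𝓜.Admissible β)
    (hcont : ∀ x ∈ 𝓜.covSpace, ∀ y ∈ posOrthant (M + 1), ContinuousOn (𝓜.logLik (x, y)) B)
    -- the smoothing parameters are nonnegative and `o(n ^ (-1/2))`
    (γ : ℕ → Fin p → Fin q → ℝ) (hγ0 : ∀ n l k, 0 ≤ γ n l k)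
    (hγ : ∀ l k, (fun n => γ n l k) =o[atTop] fun n : ℕ => (n : ℝ) ^ (-(1 / 2) : ℝ))
    -- the regularity conditions
    (hreg : 𝓜.Regular ν B B₀ β₀)
    -- independent extreme observations from the model with parameter `β₀`
    {Ω : Type*} [MeasurableSpace Ω] (P : Measure Ω) [IsProbabilityMeasure P]
    (obs : ℕ → Ω → Obs M q) (hlaw : ∀ i, HasLaw (obs i) (𝓜.law ν β₀) P)
    (hindep : iIndepFun obs P)
    -- the penalized maximum likelihood estimators
    (βhat : ℕ → Ω → Coef p q D) (hβmeas : ∀ n, AEMeasurable (βhat n) P)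
    (hβhat : ∀ n, ∀ᵐ ω ∂P, 𝓜.IsPMLE n (fun i => obs i ω) (γ n) B (βhat n ω)) :
    -- `i(β) = E {X_VAMᵀ W(β) X_VAM}`
    (∀ β ∈ B₀, ∀ a b,
      Integrable (fun z => ((𝓜.design z.1)ᵀ * 𝓜.weight z β * 𝓜.design z.1) a b) (𝓜.law ν β) ∧
      𝓜.info ν β a b =
        ∫ z, ((𝓜.design z.1)ᵀ * 𝓜.weight z β * 𝓜.design z.1) a b ∂(𝓜.law ν β)) ∧
    IsBigOInProb P (fun n ω => ‖βhat n ω - β₀‖) (fun n => (n : ℝ) ^ (-(1 / 2) : ℝ)) ∧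
    TendstoInDistribution (fun (n : ℕ) ω => Real.sqrt (n : ℝ) • (βhat n ω - β₀)) atTop id (fun _ => P)
      (multivariateGaussian (0 : Coef p q D) (𝓜.info ν β₀)⁻¹) := by
  refine ⟨fun β hβ a b => hreg.info_eq_integral_weight hν hBadm hβ a b, ?_⟩
  have hpos := hreg.info_posDef β₀ hreg.mem
  obtain ⟨hc, F, hF, hFb⟩ := hreg.exists_bound_logLik hν hcont
  obtain ⟨K, hK, hKb⟩ := hreg.exists_bound_third hν
  obtain ⟨hH, hHinfo⟩ := hreg.integral_hessian hν hBadm hreg.mem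
  have hint : ∀ β ∈ B, Integrable (fun z => 𝓜.logLik z β) (𝓜.law ν β₀) := fun β hβ =>
    hF.mono' (𝓜.measurable_logLik β).aestronglyMeasurable (hFb.mono fun z hz => hz β hβ)
  have hγ' : ∀ l k, Tendsto (fun n => γ n l k) atTop (𝓝 0) := fun l k =>
    (hγ l k).trans_tendsto ((tendsto_rpow_neg_atTop (by norm_num)).comp tendsto_natCast_atTop_atTop)
  obtain ⟨c, hc0, hQc⟩ := Model.exists_penaltyForm_bound (𝓜 := 𝓜) hγ' hBcompact
  -- The limit of the averaged negative Hessians serves as `J`; the information identity makes its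
  -- matrix the score covariance.
  have hJ : ∀ a b, (-∫ z, fderiv ℝ (fderiv ℝ (𝓜.logLik z)) β₀ ∂(𝓜.law ν β₀))
      (EuclideanSpace.single a 1) (EuclideanSpace.single b 1) = 𝓜.info ν β₀ a b := fun a b => by
    rw [neg_apply, neg_apply, ContinuousLinearMap.integral_apply hH,
      ContinuousLinearMap.integral_apply (hH.apply_continuousLinearMap _), hHinfo, neg_neg]
  exact penalized_maximizer_asymptotics hlaw hindep hBcompact hreg.isOpen hreg.mem hreg.subset
    (fun β _ => 𝓜.measurable_logLik β) hc hF hFb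
    (fun β hβ hne => hreg.integral_logLik_lt hν hBadm hint hβ hne)
    (𝓜.ae_law_of_ae (hreg.ae_contDiffOn hν)) hK hKb (dualMatrixCLM_inv_bilin hJ hpos) hH
    (neg_neg _).symm hpos.inv.posSemidef (hreg.memLp_standardized_score hreg.mem _)
    (hreg.integral_standardized_score hν hBadm hreg.mem _)
    (hreg.integral_inner_standardized_score_sq hν hBadm hreg.mem)
    (fun n => (Model.contDiff_penaltyForm (γ n)).differentiable one_ne_zero) hc0 hQc hβmeas
    (fun n => (hβhat n).mono fun ω h => h.1) (fun n => (hβhat n).mono fun ω h => h.2)
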